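/- Let $n\ge 3$ and $1\le k\le n-2$. Let $e_1,\dots,e_{2n}$ be the standard basis of $V=\mathbb C^{2n}$, and let $\mathfrak{so}_{2n}$ be the Lie algebra of matrices that are skew-adjoint for the symmetric form whose matrix has ones on the antidiagonal and zeros elsewhere. Its Cartan subalgebra consists of the diagonal matrices $\mathrm{diag}(t_1,\dots,t_n,-t_n,\dots,-t_1)$, let $\varepsilon_i$ denote the weight $t\mapsto t_i$, and let $\mathfrak n^-$ be the subalgebra of strictly lower triangular matrices in $\mathfrak{so}_{2n}$. The positive roots are $\varepsilon_i\pm\varepsilon_j$ ($1\le i<j\le n$), $W$ is the Weyl group (generated by the reflections in the roots), and $\omega_k=\varepsilon_1+\dots+\varepsilon_k$. Realize the fundamental module $V_{\omega_k}$ as $\Lambda^k V$, with highest weight vector $v_{\omega_k}=e_1\wedge\dots\wedge e_k$, and put $$F_s=\mathrm{span}\{x_1\cdots x_l\,v_{\omega_k} : x_1,\dots,x_l\in\mathfrak n^-,\ l\le s\},\qquad s\ge 0 .$$ The PBW degree of $v\in V_{\omega_k}$ is the least $s$ with $v\in F_s$. For $w\in W$ let $v_{w(\omega_k)}$ be a nonzero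 vector of weight $w(\omega_k)$ in $V_{\omega_k}$ (it is unique up to a scalar), let $d(\omega_k,w)$ be its PBW degree, and let $n(\omega_k,w)$ be the minimal number of terms in a decomposition of $\omega_k-w(\omega_k)$ as a sum of positive roots (with repetitions allowed). Then for every $w\in W$ both numbers are defined (such an $s$ and such a decomposition exist), and $$d(\omega_k,w)=n(\omega_k,w)$$ unless there is a subset $I\subset\{1,\dots,k\}$ with $\# I=2s+3$ for some integer $s\ge 0$ such that, up to a nonzero scalar, $$v_{w(\omega_k)}=\bigwedge_{i\le k,\ i\notin I}e_i\ \wedge\ \bigwedge_{i\in I}e_{2n+1-i}.$$ In the latter case $d(\omega_k,w)=n(\omega_k,w)+1$. -/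

import Mathlib

/-! The bracket on `Module.End` and on square matrices is the commutator. -/

attribute [local instance 100] LieRing.ofAssociativeRing

/-! ### The action of endomorphisms on exterior powers -/

namespace ExtPow

open exteriorPower

variable {R M : Type*} [CommRing R] [AddCommGroup M] [Module R M]

/-- `x` placed at position `l` and the identity at all other positions. -/
def atPos {k : ℕ} (x : Module.End R M) (l j : Fin k) : Module.End R M :=
  if j = l then x else LinearMap.id

/-- The alternating map `(v₁, …, v_k) ↦ ∑ l, v₁ ∧ … ∧ x v_l ∧ … ∧ v_k`. -/
noncomputable def actAlt (k : ℕ) (x : Module.End R M) : M [⋀^Fin k]→ₗ[R] ⋀[R]^k M :=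
  { (∑ l : Fin k, (ιMulti R k (M := M)).toMultilinearMap.compLinearMap (atPos x l) :
      MultilinearMap R (fun _ : Fin k => M) (⋀[R]^k M)) with
    map_eq_zero_of_eq' := by
      intro v i j hv hij
      change (∑ l : Fin k, (ιMulti R k (M := M)).toMultilinearMap.compLinearMap (atPos x l) :
        MultilinearMap R (fun _ : Fin k => M) (⋀[R]^k M)) v = 0
      rw [sum_apply, ← Finset.add_sum_erase _ _ (Finset.mem_univ i),
        ← Finset.add_sum_erase _ _ (Finset.mem_erase.2 ⟨hij.symm, Finset.mem_univ j⟩),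
        Finset.sum_eq_zero, add_zero]
      · simp only [MultilinearMap.compLinearMap_apply]
        have h := (ιMulti R k (M := M)).map_swap (fun m => atPos x i m (v m)) hij
        have h2 : (fun m => atPos x i m (v m)) ∘ Equiv.swap i j
            = fun m => atPos x j m (v m) := by
          funext m
          simp only [Function.comp, atPos]
          rcases eq_or_ne m i with rfl | hmi
          · simp [hij, hij.symm, hv]
          · rcases eq_or_ne m j with rfl | hmj
            · simp [hv]
            · rw [Equiv.swap_apply_of_ne_of_ne hmi hmj]
              simp [hmi, hmj]
        rw [h2] at h
        change (ιMulti R k) (fun m => atPos x i m (v m))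
          + (ιMulti R k) (fun m => atPos x j m (v m)) = 0
        rw [h, add_neg_cancel]
      · intro l hl
        simp only [Finset.mem_erase] at hl
        change (ιMulti R k) (fun m => atPos x l m (v m)) = 0
        refine (ιMulti R k).map_eq_zero_of_eq _ ?_ hij
        simp [atPos, hl.1.symm, hl.2.1.symm, hv] }

/-- The endomorphism of `⋀^k M` induced by `x`, as a derivation. -/
noncomputable def act (k : ℕ) (x : Module.End R M) : Module.End R (⋀[R]^k M) :=
  alternatingMapLinearEquiv (actAlt k x)

theorem act_ιMulti (k : ℕ) (x : Module.End R M) (v : Fin k → M) :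
    act k x (ιMulti R k v) = ∑ l : Fin k, ιMulti R k (fun j => atPos x l j (v j)) := by
  rw [act, alternatingMapLinearEquiv_apply_ιMulti]
  change (∑ l : Fin k, (ιMulti R k (M := M)).toMultilinearMap.compLinearMap (atPos x l) :
        MultilinearMap R (fun _ : Fin k => M) (⋀[R]^k M)) v = _
  rw [sum_apply]
  rfl

/-- The usual formula `x · (v₁ ∧ … ∧ v_k) = ∑ l, v₁ ∧ … ∧ x v_l ∧ … ∧ v_k`. -/
theorem act_ιMulti_update (k : ℕ) (x : Module.End R M) (v : Fin k → M) :
    act k x (ιMulti R k v) = ∑ l : Fin k, ιMulti R k (Function.update v l (x (v l))) := by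
  rw [act_ιMulti]
  refine Finset.sum_congr rfl fun l _ => congrArg _ (funext fun j => ?_)
  rcases eq_or_ne j l with rfl | h
  · simp [atPos]
  · simp [atPos, h]

/-- The representation of the Lie algebra `End M` on `⋀^k M`. -/
noncomputable def rep (R M : Type*) [CommRing R] [AddCommGroup M] [Module R M] (k : ℕ) :
    Module.End R M →ₗ⁅R⁆ Module.End R (⋀[R]^k M) where
  toFun := act k
  map_add' x y := by
    refine linearMap_ext (AlternatingMap.ext fun v => ?_)
    simp only [LinearMap.compAlternatingMap_apply, LinearMap.add_apply, act_ιMulti_update,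
      AlternatingMap.map_update_add, Finset.sum_add_distrib]
  map_smul' c x := by
    refine linearMap_ext (AlternatingMap.ext fun v => ?_)
    simp only [LinearMap.compAlternatingMap_apply, LinearMap.smul_apply, act_ιMulti_update,
      AlternatingMap.map_update_smul, Finset.smul_sum, RingHom.id_apply]
  map_lie' {x y} := by
    refine linearMap_ext (AlternatingMap.ext fun v => ?_)
    simp only [LinearMap.compAlternatingMap_apply, Ring.lie_def, LinearMap.sub_apply,
      Module.End.mul_apply]
    simp only [act_ιMulti, map_sum]
    conv_rhs => rw [sub_eq_add_neg]; arg 2; rw [Finset.sum_comm]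
    rw [← sub_eq_add_neg, ← Finset.sum_sub_distrib]
    refine Finset.sum_congr rfl fun l _ => ?_
    rw [← Finset.sum_sub_distrib, Finset.sum_eq_single l]
    · have h1 : (fun j => atPos (x * y - y * x) l j (v j))
          = Function.update v l (x (y (v l)) - y (x (v l))) := by
        funext j
        rcases eq_or_ne j l with rfl | h <;> simp [atPos, *]
      have h2 : ∀ a b : Module.End R M, (fun j => atPos a l j (atPos b l j (v j)))
          = Function.update v l (a (b (v l))) := by
        intro a b
        funext j
        rcases eq_or_ne j l with rfl | h <;> simp [atPos, *]
      rw [h1, h2, h2, AlternatingMap.map_update_sub]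
    · intro m _ hm
      rw [sub_eq_zero]
      refine congrArg _ (funext fun j => ?_)
      rcases eq_or_ne j l with rfl | h
      · simp [atPos, hm.symm]
      · simp [atPos, h]
    · simp

end ExtPow

/-! ### The PBW filtration -/

namespace PBW

variable {L M : Type*} [LieRing L] [LieAlgebra ℂ L] [AddCommGroup M] [Module ℂ M]

/-- `F_s = span {x₁ ⋯ x_l v₀ : x_i ∈ N, l ≤ s}` for a representation `ρ` of a Lie algebra `L`,
a subalgebra `N` of `L` and a vector `v₀`. -/
def filtration (ρ : L →ₗ⁅ℂ⁆ Module.End ℂ M) (N : LieSubalgebra ℂ L) (v₀ : M) (s : ℕ) :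
    Submodule ℂ M :=
  Submodule.span ℂ
    {u | ∃ xs : List L, (∀ x ∈ xs, x ∈ N) ∧ xs.length ≤ s ∧ u = (xs.map ρ).prod v₀}

/-- `v` has PBW degree `d`: it lies in `F_d`, but in no `F_s` with `s < d`. -/
def HasDegree (ρ : L →ₗ⁅ℂ⁆ Module.End ℂ M) (N : LieSubalgebra ℂ L) (v₀ v : M) (d : ℕ) : Prop :=
  IsLeast {s : ℕ | v ∈ filtration ρ N v₀ s} d

end PBW

namespace TypeD

open exteriorPower

/-! ### The root system `D_n`, in the coordinates given by `ε₁, …, ε_n` -/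

/-- The positive roots `ε_i ± ε_j`, `i < j`. -/
def posRoots (n : ℕ) : Set (Fin n → ℤ) :=
  {α | ∃ i j : Fin n, i < j ∧
    (α = Pi.single i 1 - Pi.single j 1 ∨ α = Pi.single i 1 + Pi.single j 1)}

/-- The Weyl group, generated by the reflections `s_α : x ↦ x - (x, α) α`, where
`(α, α) = 2` for all roots. -/
def weylGroup (n : ℕ) : Subgroup ((Fin n → ℤ) ≃ₗ[ℤ] (Fin n → ℤ)) :=
  Subgroup.closure {g | ∃ α ∈ posRoots n, ∀ x, g x = x - (x ⬝ᵥ α) • α}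

/-- `ω_k = ε₁ + … + ε_k`; this is the `k`-th fundamental weight for `k ≤ n - 2`. -/
def omega (n k : ℕ) : Fin n → ℤ := fun i => if (i : ℕ) < k then 1 else 0

/-- `N` is the minimal number of terms in a decomposition of `lam - w(lam)` as a sum of positive
roots (with repetitions allowed). -/
def IsKostantDegree {n : ℕ} (lam : Fin n → ℤ) (w : (Fin n → ℤ) ≃ₗ[ℤ] (Fin n → ℤ)) (N : ℕ) : Prop :=
  IsLeast {m : ℕ | ∃ S : Multiset (Fin n → ℤ),
    (∀ α ∈ S, α ∈ posRoots n) ∧ S.sum = lam - w lam ∧ Multiset.card S = m} N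

/-! ### The Lie algebra `so_{2n}` and its representations -/

/-- The symmetric form on `ℂ^{2n}`: ones on the antidiagonal, zeros elsewhere. -/
def form (n : ℕ) : Matrix (Fin (2 * n)) (Fin (2 * n)) ℂ :=
  Matrix.of fun i j => if j = i.rev then 1 else 0

/-- `so_{2n}`, the matrices that are skew-adjoint for the form above. -/
abbrev so (n : ℕ) : LieSubalgebra ℂ (Matrix (Fin (2 * n)) (Fin (2 * n)) ℂ) :=
  skewAdjointMatricesLieSubalgebra (form n)

/-- The subalgebra `n⁻` of `so_{2n}`: the strictly lower triangular matrices in it. -/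
def nMinus (n : ℕ) : LieSubalgebra ℂ (so n) where
  carrier := {x | ∀ i j, i ≤ j → x.1 i j = 0}
  zero_mem' := fun _ _ _ => rfl
  add_mem' := by
    intro a b ha hb i j hij
    change a.1 i j + b.1 i j = 0
    rw [ha i j hij, hb i j hij, add_zero]
  smul_mem' := by
    intro c a ha i j hij
    change c * a.1 i j = 0
    rw [ha i j hij, mul_zero]
  lie_mem' := by
    intro a b ha hb i j hij
    have key : ∀ p q : so n, (∀ i j, i ≤ j → p.1 i j = 0) → (∀ i j, i ≤ j → q.1 i j = 0) →
        (p.1 * q.1) i j = 0 := by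
      intro p q hp hq
      rw [Matrix.mul_apply]
      refine Finset.sum_eq_zero fun l _ => ?_
      rcases le_total i l with h | h
      · rw [hp i l h, zero_mul]
      · rw [hq l j (h.trans hij), mul_zero]
    change (a.1 * b.1 - b.1 * a.1) i j = 0
    rw [Matrix.sub_apply, key a b ha hb, key b a hb ha, sub_zero]

/-- The representation of `so_{2n}` on `⋀^k ℂ^{2n}`. -/
noncomputable def extRep (n k : ℕ) :
    so n →ₗ⁅ℂ⁆ Module.End ℂ (⋀[ℂ]^k (Fin (2 * n) → ℂ)) :=
  (ExtPow.rep ℂ (Fin (2 * n) → ℂ) k).comp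
    ((lieEquivMatrix' (R := ℂ) (n := Fin (2 * n))).symm.toLieHom.comp (so n).incl)

/-- `v` has weight `μ`: every diagonal matrix `h = diag(t₁, …, t_n, -t_n, …, -t₁)` in `so_{2n}`
acts on `v` as multiplication by `∑ i, μ_i t_i`. -/
def HasWeight {n k : ℕ} (μ : Fin n → ℤ) (v : ⋀[ℂ]^k (Fin (2 * n) → ℂ)) : Prop :=
  ∀ h : so n, h.1.IsDiag →
    extRep n k h v = (∑ i : Fin n,
      (μ i : ℂ) * h.1 (i.castLE (by omega)) (i.castLE (by omega))) • v

/-- The wedge product of the `e_i`, `i ≤ k`, `i ∉ I`, and the `e_{2n+1-i}`, `i ∈ I` (in increasing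
order of `i`; the order only affects the sign). -/
noncomputable def flipWedge {n k : ℕ} (hk : k ≤ 2 * n) (I : Finset (Fin k)) :
    ⋀[ℂ]^k (Fin (2 * n) → ℂ) :=
  ιMulti ℂ k fun i =>
    if i ∈ I then Pi.single (i.castLE hk).rev 1 else Pi.single (i.castLE hk) 1

/-- The highest weight vector `e₁ ∧ … ∧ e_k`. -/
noncomputable def highestVector {n k : ℕ} (hk : k ≤ 2 * n) : ⋀[ℂ]^k (Fin (2 * n) → ℂ) :=
  ιMulti ℂ k fun i => Pi.single (i.castLE hk) 1

/-- `v` is, up to a scalar, a wedge product as above with `#I = 2s + 3`, `s ≥ 0`. -/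
def IsSpecial {n k : ℕ} (hk : k ≤ 2 * n) (v : ⋀[ℂ]^k (Fin (2 * n) → ℂ)) : Prop :=
  ∃ (I : Finset (Fin k)) (s : ℕ) (c : ℂ), I.card = 2 * s + 3 ∧ c ≠ 0 ∧ v = c • flipWedge hk I

end TypeD

/-! Every extremal weight vector is, up to a scalar, a wedge of basis vectors. Its indices can be
ordered so that position `i` carries `i`, its opposite `i'`, or an index in the middle range
(`Admissible`). Let `a` be the number of middle entries and `b` the number of opposite ones. The PBW
degree is `a + b`, plus 1 if `a = 0` and `b` is odd. The minimal number of roots is `a + b`, plus 1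
if `a = 0` and `b = 1`. The two differ exactly when `a = 0` and `b ≥ 3` is odd, which is the special
case.

Upper bounds: a middle entry costs one root operator. There is no root `2ε_i`, so one operator
cannot make a single flip. Two flips come from the square of the operator for `ε_i + ε_j`, a flip
and a middle entry from two operators, and an isolated flip from two operators passing through a
middle index. `Admissible.induction` packages these moves for operators and for roots alike. For
roots alone there is one more move, `2(ε_i + ε_j + ε_l) = (ε_i + ε_j) + (ε_i + ε_l) + (ε_j + ε_l)`,
so three flips cost three.

Lower bounds: for roots, pair with a suitable vector of signs, and look at one coordinate when there
is a flip. For PBW degrees, one operator moves at most one index out of the first `k`, which gives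
`a + b`. If `a = 0` and `b` is odd, give the flipped indices height -1 and their opposites height 1.
Each operator raises the total height by at most 2, and it must go from `-b` to `b`. With `b`
factors only the parts raising it by exactly 2 matter. These commute and are skew-adjoint for a
symmetric form whose pairing with the highest weight vector reads off the wanted coefficient. An odd
product `Y` of such operators satisfies `B(v, Yv) = -B(v, Yv)`, so the coefficient is zero
(`numFlip_lt_of_mem_filtration`). -/

namespace ExtPow

open exteriorPower

/-! ### Wedges of basis vectors and their coefficients -/

variable {d k : ℕ}

/-- The wedge product `e_{g 0} ∧ … ∧ e_{g (k-1)}` of standard basis vectors. -/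
noncomputable def wedge (g : Fin k → Fin d) : ⋀[ℂ]^k (Fin d → ℂ) :=
  ιMulti ℂ k fun l => Pi.single (g l) 1

theorem wedge_comp_perm (g : Fin k → Fin d) (σ : Equiv.Perm (Fin k)) :
    wedge (g ∘ σ) = Equiv.Perm.sign σ • wedge g :=
  (ιMulti ℂ k).map_perm (fun l => (Pi.single (g l) 1 : Fin d → ℂ)) σ

theorem wedge_comp_swap (g : Fin k → Fin d) {i j : Fin k} (h : i ≠ j) :
    wedge (g ∘ Equiv.swap i j) = -wedge g := by
  rw [wedge_comp_perm, Equiv.Perm.sign_swap h]; simp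

theorem span_wedge : Submodule.span ℂ (Set.range (wedge (d := d) (k := k))) = ⊤ := by
  rw [eq_top_iff, ← ιMulti_family_span_of_span ℂ (Pi.basisFun ℂ (Fin d)).span_eq]
  refine Submodule.span_mono ?_
  rintro _ ⟨s, rfl⟩
  refine ⟨Set.powersetCard.ofFinEmbEquiv.symm s, ?_⟩
  rw [ιMulti_family, wedge]
  congr 1
  funext l
  simp

theorem ext_wedge {N : Type*} [AddCommGroup N] [Module ℂ N] {φ ψ : ⋀[ℂ]^k (Fin d → ℂ) →ₗ[ℂ] N}
    (h : ∀ g, φ (wedge g) = ψ (wedge g)) : φ = ψ :=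
  LinearMap.ext_on span_wedge (by rintro _ ⟨g, rfl⟩; exact h g)

/-- The coefficient at `wedge f`. -/
noncomputable def coeff (f : Fin k → Fin d) : ⋀[ℂ]^k (Fin d → ℂ) →ₗ[ℂ] ℂ :=
  pairingDual ℂ _ k (ιMulti ℂ k fun i => LinearMap.proj (f i))

theorem coeff_ιMulti (f : Fin k → Fin d) (v : Fin k → Fin d → ℂ) :
    coeff f (ιMulti ℂ k v) = Matrix.det (.of fun i j => v i (f j)) := by
  rw [coeff, pairingDual_ιMulti_ιMulti]; rfl

theorem coeff_wedge_self {f : Fin k → Fin d} (hf : Function.Injective f) :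
    coeff f (wedge f) = 1 := by
  rw [wedge, coeff_ιMulti, ← Matrix.det_one (n := Fin k)]
  congr 1
  ext i j
  simp [Pi.single_apply, Matrix.one_apply, hf.eq_iff, eq_comm]

/-- A nonzero determinant has a nonzero Leibniz term, and its permutation matches the two tuples. -/
theorem exists_perm_of_coeff_wedge_ne_zero {f g : Fin k → Fin d} (h : coeff f (wedge g) ≠ 0) :
    ∃ σ : Equiv.Perm (Fin k), f ∘ σ = g := by
  rw [wedge, coeff_ιMulti, Matrix.det_apply] at h
  obtain ⟨σ, -, hσ⟩ := Finset.exists_ne_zero_of_sum_ne_zero h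
  refine ⟨σ⁻¹, funext fun i => ?_⟩
  have h1 : ∏ i, (Pi.single (g (σ i)) 1 : Fin d → ℂ) (f i) ≠ 0 := by
    intro h0
    refine hσ ?_
    simp only [Matrix.of_apply, h0, smul_zero]
  have h2 := Finset.prod_ne_zero_iff.1 h1 (σ⁻¹ i) (Finset.mem_univ _)
  by_contra h3
  refine h2 ?_
  rw [show σ (σ⁻¹ i) = i from σ.apply_symm_apply i]
  exact Pi.single_eq_of_ne h3 _

theorem act_toLin'_wedge (X : Matrix (Fin d) (Fin d) ℂ) (g : Fin k → Fin d) :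
    act k (Matrix.toLin' X) (wedge g) =
      ∑ l, ∑ m, X m (g l) • wedge (Function.update g l m) := by
  rw [wedge, act_ιMulti_update]
  refine Finset.sum_congr rfl fun l _ => ?_
  have h1 : Matrix.toLin' X (Pi.single (g l) 1) = ∑ m, X m (g l) • Pi.single m (1 : ℂ) := by
    ext m
    simp [Finset.sum_apply, Pi.single_apply]
  rw [h1, AlternatingMap.map_update_sum]
  refine Finset.sum_congr rfl fun m _ => ?_
  rw [AlternatingMap.map_update_smul, wedge]
  congr 2
  funext j
  rcases eq_or_ne j l with rfl | h <;> simp [*]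

/-! ### Filtrations by a height function on the index set -/

/-- The span of the wedge products of total height at most `c`. -/
noncomputable def heightFiltration (k : ℕ) (h : Fin d → ℤ) (c : ℤ) :
    Submodule ℂ (⋀[ℂ]^k (Fin d → ℂ)) :=
  Submodule.span ℂ {u | ∃ g : Fin k → Fin d, ∑ l, h (g l) ≤ c ∧ u = wedge g}

theorem wedge_mem_heightFiltration {h : Fin d → ℤ} {c : ℤ} {g : Fin k → Fin d}
    (hg : ∑ l, h (g l) ≤ c) : wedge g ∈ heightFiltration k h c :=
  Submodule.subset_span ⟨g, hg, rfl⟩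

/-- Each term of the derivation replaces a single index, so the total height grows by at most the
growth `r` of one matrix entry. -/
theorem act_mem_heightFiltration {h : Fin d → ℤ} {r : ℤ} {X : Matrix (Fin d) (Fin d) ℂ}
    (hX : ∀ m j, X m j ≠ 0 → h m ≤ h j + r) {c : ℤ} {u : ⋀[ℂ]^k (Fin d → ℂ)}
    (hu : u ∈ heightFiltration k h c) :
    act k (Matrix.toLin' X) u ∈ heightFiltration k h (c + r) := by
  induction hu using Submodule.span_induction with
  | mem u hu =>
    obtain ⟨g, hg, rfl⟩ := hu
    rw [act_toLin'_wedge]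
    refine Submodule.sum_mem _ fun l _ => Submodule.sum_mem _ fun m _ => ?_
    by_cases h0 : X m (g l) = 0
    · simp [h0]
    refine Submodule.smul_mem _ _ (wedge_mem_heightFiltration ?_)
    have h1 : ∑ j, h (Function.update g l m j) = ∑ j, h (g j) - h (g l) + h m := by
      rw [← Finset.add_sum_erase _ _ (Finset.mem_univ l),
        ← Finset.add_sum_erase _ (fun j => h (g j)) (Finset.mem_univ l)]
      rw [Finset.sum_congr rfl fun j hj => by
        rw [Function.update_of_ne (Finset.ne_of_mem_erase hj)]]
      simp only [Function.update_self]
      ring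
    have := hX m (g l) h0
    rw [h1]; linarith
  | zero => simp
  | add u v _ _ hu hv => rw [map_add]; exact add_mem hu hv
  | smul a u _ hu => rw [map_smul]; exact Submodule.smul_mem _ _ hu

/-- Total height does not depend on the order of the indices. This is how heights become lower
bounds for PBW degrees. -/
theorem coeff_eq_zero_of_mem_heightFiltration {h : Fin d → ℤ} {c : ℤ} {f : Fin k → Fin d}
    (hf : c < ∑ l, h (f l)) {u : ⋀[ℂ]^k (Fin d → ℂ)} (hu : u ∈ heightFiltration k h c) :
    coeff f u = 0 := by
  induction hu using Submodule.span_induction with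
  | mem u hu =>
    obtain ⟨g, hg, rfl⟩ := hu
    by_contra h0
    obtain ⟨σ, rfl⟩ := exists_perm_of_coeff_wedge_ne_zero h0
    have := Equiv.sum_comp σ fun l => h (f l)
    simp only [Function.comp_apply] at hg
    omega
  | zero => simp
  | add u v _ _ hu hv => rw [map_add, hu, hv, add_zero]
  | smul a u _ hu => rw [map_smul, hu, smul_zero]

theorem heightFiltration_mono (h : Fin d → ℤ) {c c' : ℤ} (hc : c ≤ c') :
    heightFiltration k h c ≤ heightFiltration k h c' :=
  Submodule.span_mono fun _ ⟨g, hg, e⟩ => ⟨g, hg.trans hc, e⟩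

/-! ### The bilinear form on an exterior power -/

/-- The bilinear form on `⋀^k M` induced by one on `M`. -/
noncomputable def wedgeForm {M : Type*} [AddCommGroup M] [Module ℂ M] (k : ℕ)
    (B : M →ₗ[ℂ] Module.Dual ℂ M) : ⋀[ℂ]^k M →ₗ[ℂ] Module.Dual ℂ (⋀[ℂ]^k M) :=
  pairingDual ℂ M k ∘ₗ exteriorPower.map k B

section
variable {M : Type*} [AddCommGroup M] [Module ℂ M] {B : M →ₗ[ℂ] Module.Dual ℂ M}

theorem wedgeForm_ιMulti (u v : Fin k → M) :
    wedgeForm k B (ιMulti ℂ k u) (ιMulti ℂ k v) = Matrix.det (.of fun i j => B (u j) (v i)) := by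
  rw [wedgeForm, LinearMap.comp_apply, map_apply_ιMulti, pairingDual_ιMulti_ιMulti]; rfl

theorem wedgeForm_comm (hB : ∀ u v, B u v = B v u) (u v : ⋀[ℂ]^k M) :
    wedgeForm k B u v = wedgeForm k B v u := by
  suffices wedgeForm k B = (wedgeForm k B).flip from LinearMap.congr_fun₂ this u v
  refine linearMap_ext (AlternatingMap.ext fun u => linearMap_ext (AlternatingMap.ext fun v => ?_))
  simp only [LinearMap.compAlternatingMap_apply, LinearMap.flip_apply, wedgeForm_ιMulti]
  rw [← Matrix.det_transpose]
  congr 1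
  ext i j
  exact hB _ _

theorem sum_det_updateCol {m : Type*} [Fintype m] [DecidableEq m] (A K : Matrix m m ℂ) :
    ∑ l, (A.updateCol l fun i => K i l).det = Matrix.trace (A.adjugate * K) := by
  refine Finset.sum_congr rfl fun l _ => ?_
  rw [← Matrix.cramer_apply, Matrix.cramer_eq_adjugate_mulVec]
  rfl

/-- Both sums are the derivative of the determinant at `A` in direction `K`, namely the trace of
`A.adjugate * K`. -/
theorem sum_det_updateRow {m : Type*} [Fintype m] [DecidableEq m] (A K : Matrix m m ℂ) :
    ∑ l, (A.updateRow l (K l)).det = ∑ l, (A.updateCol l fun i => K i l).det := by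
  have h1 : ∀ l, (A.updateRow l (K l)).det = (A.transpose.updateCol l fun i => K.transpose i l).det := by
    intro l
    rw [← Matrix.det_transpose, Matrix.updateCol_transpose]
    rfl
  rw [Finset.sum_congr rfl fun l _ => h1 l, sum_det_updateCol, sum_det_updateCol,
    ← Matrix.adjugate_transpose, ← Matrix.transpose_mul, Matrix.trace_transpose, Matrix.trace_mul_comm]

/-- Acting on one argument updates the columns of the Gram matrix, acting on the other updates its
rows. Up to sign, the updates come from the same matrix. -/
theorem wedgeForm_act {y : Module.End ℂ M} (hy : ∀ u v, B (y u) v = -B u (y v))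
    (u v : ⋀[ℂ]^k M) :
    wedgeForm k B (act k y u) v = -wedgeForm k B u (act k y v) := by
  suffices wedgeForm k B ∘ₗ act k y = -((wedgeForm k B).flip ∘ₗ act k y).flip from
    LinearMap.congr_fun₂ this u v
  refine linearMap_ext (AlternatingMap.ext fun u => linearMap_ext (AlternatingMap.ext fun v => ?_))
  simp only [LinearMap.compAlternatingMap_apply, LinearMap.flip_apply, LinearMap.comp_apply,
    LinearMap.neg_apply, act_ιMulti_update, map_sum, LinearMap.sum_apply, wedgeForm_ιMulti]
  have h1 : ∀ l, (Matrix.of fun i j => B (Function.update u l (y (u l)) j) (v i))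
      = (Matrix.of fun i j => B (u j) (v i)).updateCol l fun i => -B (u l) (y (v i)) := by
    intro l
    ext i j
    rcases eq_or_ne j l with rfl | h <;> simp [*]
  have h2 : ∀ l, (Matrix.of fun i j => B (u j) (Function.update v l (y (v l)) i))
      = (Matrix.of fun i j => B (u j) (v i)).updateRow l fun j => B (u j) (y (v l)) := by
    intro l
    ext i j
    rcases eq_or_ne i l with rfl | h <;> simp [Matrix.updateRow_apply, *]
  simp only [h1, h2]
  have h3 := sum_det_updateRow (Matrix.of fun i j => B (u j) (v i))
    (Matrix.of fun i j => B (u j) (y (v i)))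
  have h4 : ∀ l, ((Matrix.of fun i j => B (u j) (v i)).updateCol l fun i => -B (u l) (y (v i))).det
      = -((Matrix.of fun i j => B (u j) (v i)).updateCol l fun i => B (u l) (y (v i))).det := by
    intro l
    have := Matrix.det_updateCol_smul (Matrix.of fun i j => B (u j) (v i)) l (-1)
      fun i => B (u l) (y (v i))
    rw [neg_one_smul, neg_one_mul] at this
    exact this
  rw [Finset.sum_congr rfl fun l _ => h4 l, Finset.sum_neg_distrib]
  exact congrArg Neg.neg h3.symm

/-- Commuting skew-adjoint operators: an odd product has no component from `u` to itself. -/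
theorem wedgeForm_prod_eq_zero_of_odd (hB : ∀ u v, B u v = B v u) {ys : List (Module.End ℂ M)}
    (hs : ∀ y ∈ ys, ∀ u v, B (y u) v = -B u (y v)) (hc : ∀ y ∈ ys, ∀ z ∈ ys, y * z = z * y)
    (ho : Odd ys.length) (u : ⋀[ℂ]^k M) :
    wedgeForm k B u ((ys.map (act k)).prod u) = 0 := by
  -- Moving the factors across the form one at a time produces the sign and reverses their order.
  -- Commutativity (`h2`) undoes the reversal, and symmetry of the form then equates the value with
  -- its negative.
  have h1 : ∀ (zs : List (Module.End ℂ M)), (∀ y ∈ zs, ∀ u v, B (y u) v = -B u (y v)) →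
      ∀ u v : ⋀[ℂ]^k M, wedgeForm k B u ((zs.map (act k)).prod v)
        = (-1) ^ zs.length * wedgeForm k B ((zs.map (act k)).reverse.prod u) v := by
    intro zs
    induction zs with
    | nil => simp
    | cons y zs ih =>
      intro hz u v
      rw [List.map_cons, List.prod_cons, Module.End.mul_apply, ← neg_neg (wedgeForm k B u _),
        ← wedgeForm_act (hz y (by simp)), ih (fun z h => hz z (by simp [h])), List.reverse_cons,
        List.prod_append, List.prod_singleton, List.length_cons, pow_succ, Module.End.mul_apply]
      ring
  have h2 : (ys.map (act k)).reverse.prod = (ys.map (act (R := ℂ) (M := M) k)).prod := by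
    refine (List.reverse_perm _).prod_eq' ?_
    rw [List.pairwise_reverse]
    refine List.pairwise_of_forall_mem_list ?_
    simp only [List.mem_map]
    rintro _ ⟨y, hy, rfl⟩ _ ⟨z, hz, rfl⟩
    have h3 := (rep ℂ M k).map_lie z y
    rw [Ring.lie_def, Ring.lie_def, hc z hz y hy, sub_self, map_zero] at h3
    exact sub_eq_zero.1 h3.symm
  have h4 := h1 ys hs u u
  rw [h2, ho.neg_one_pow, wedgeForm_comm hB _ u] at h4
  linear_combination h4 / 2

end

end ExtPow

/-! ### Combinatorics of index tuples in normal form -/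

namespace TypeD

variable {n k : ℕ}

/-- Index tuples of the extremal weight vectors, in a normal form: the `i`-th index is `i`, its
opposite, or lies in the middle range. -/
structure Admissible (hk : k ≤ 2 * n) (f : Fin k → Fin (2 * n)) : Prop where
  inj : Function.Injective f
  iso : ∀ i j, f i ≠ (f j).rev
  mem : ∀ i, f i = i.castLE hk ∨ f i = (i.castLE hk).rev ∨ (k ≤ (f i : ℕ) ∧ k ≤ ((f i).rev : ℕ))

/-- The number of `i` with `f i` in the middle range. -/
def numMid (hk : k ≤ 2 * n) (f : Fin k → Fin (2 * n)) : ℕ :=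
  (Finset.univ.filter fun i => f i ≠ i.castLE hk ∧ f i ≠ (i.castLE hk).rev).card

/-- The number of `i` with `f i` opposite to `i`. -/
def numFlip (hk : k ≤ 2 * n) (f : Fin k → Fin (2 * n)) : ℕ :=
  (Finset.univ.filter fun i => f i = (i.castLE hk).rev).card

/-- The tuple with the `i`-th index reset to `i`. -/
def reset (hk : k ≤ 2 * n) (f : Fin k → Fin (2 * n)) (i : Fin k) : Fin k → Fin (2 * n) :=
  Function.update f i (i.castLE hk)

section
variable {hk : k ≤ 2 * n} {f : Fin k → Fin (2 * n)}

theorem castLE_ne_rev (hkn : k < n) (i j : Fin k) : i.castLE hk ≠ (j.castLE hk).rev := by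
  simp only [ne_eq, Fin.ext_iff, Fin.val_rev, Fin.val_castLE]; omega

theorem reset_self (i : Fin k) : reset hk f i i = i.castLE hk := Function.update_self ..

theorem reset_of_ne {i j : Fin k} (h : j ≠ i) : reset hk f i j = f j := Function.update_of_ne h ..

/-- Since `k < n`, the low, middle and high ranges are disjoint, so a low value can only sit at its
own position. -/
theorem Admissible.eq_of_apply_eq (hkn : k < n) (hf : Admissible hk f) {l i : Fin k}
    (h : f l = i.castLE hk) : l = i := by
  have := hf.mem l
  simp only [Fin.ext_iff, Fin.val_rev, Fin.val_castLE] at *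
  omega

theorem Admissible.eq_of_apply_eq_rev (hkn : k < n) (hf : Admissible hk f) {l i : Fin k}
    (h : f l = (i.castLE hk).rev) : l = i := by
  have := hf.mem l
  simp only [Fin.ext_iff, Fin.val_rev, Fin.val_castLE] at *
  omega

theorem Admissible.resetAt (hkn : k < n) (hf : Admissible hk f) (i : Fin k) :
    Admissible hk (reset hk f i) where
  inj := by
    intro a b hab
    rcases eq_or_ne a i with rfl | ha <;> rcases eq_or_ne b a with rfl | hb
    · rfl
    · rw [reset_self, reset_of_ne hb] at hab
      exact (hf.eq_of_apply_eq hkn hab.symm).symm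
    · rfl
    · rw [reset_of_ne ha] at hab
      rcases eq_or_ne b i with rfl | hb'
      · rw [reset_self] at hab
        exact hf.eq_of_apply_eq hkn hab
      · rw [reset_of_ne hb'] at hab
        exact hf.inj hab
  iso := by
    intro a b hab
    rcases eq_or_ne a i with ha | ha <;> rcases eq_or_ne b i with hb | hb
    · rw [ha, hb, reset_self] at hab
      exact castLE_ne_rev hkn i i hab
    · rw [ha, reset_self, reset_of_ne hb, ← Fin.rev_eq_iff] at hab
      exact hb (hf.eq_of_apply_eq_rev hkn hab.symm)
    · rw [hb, reset_self, reset_of_ne ha] at hab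
      exact ha (hf.eq_of_apply_eq_rev hkn hab)
    · rw [reset_of_ne ha, reset_of_ne hb] at hab
      exact hf.iso a b hab
  mem := by
    intro a
    rcases eq_or_ne a i with rfl | ha
    · exact Or.inl (reset_self _)
    · rw [reset_of_ne ha]; exact hf.mem a

theorem numMid_reset (i : Fin k) : numMid hk (reset hk f i) =
    numMid hk f - if f i ≠ i.castLE hk ∧ f i ≠ (i.castLE hk).rev then 1 else 0 := by
  have h : (Finset.univ.filter fun j => reset hk f i j ≠ j.castLE hk ∧
      reset hk f i j ≠ (j.castLE hk).rev) =
      (Finset.univ.filter fun j => f j ≠ j.castLE hk ∧ f j ≠ (j.castLE hk).rev).erase i := by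
    ext j
    rcases eq_or_ne j i with rfl | h <;> simp [reset_self, reset_of_ne, *]
  rw [numMid, h, Finset.card_erase_eq_ite, numMid]
  simp only [Finset.mem_filter, Finset.mem_univ, true_and]
  split_ifs <;> rfl

theorem numFlip_reset (hkn : k < n) (i : Fin k) : numFlip hk (reset hk f i) =
    numFlip hk f - if f i = (i.castLE hk).rev then 1 else 0 := by
  have h : (Finset.univ.filter fun j => reset hk f i j = (j.castLE hk).rev) =
      (Finset.univ.filter fun j => f j = (j.castLE hk).rev).erase i := by
    ext j
    rcases eq_or_ne j i with rfl | h <;> simp [reset_self, reset_of_ne, castLE_ne_rev hkn, *]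
  rw [numFlip, h, Finset.card_erase_eq_ite, numFlip]
  simp only [Finset.mem_filter, Finset.mem_univ, true_and]
  split_ifs <;> rfl

theorem numMid_eq_zero_iff :
    numMid hk f = 0 ↔ ∀ i, f i = i.castLE hk ∨ f i = (i.castLE hk).rev := by
  rw [numMid, Finset.card_eq_zero, Finset.filter_eq_empty_iff]
  simp only [Finset.mem_univ, true_imp_iff, not_and_or, not_not, ne_eq]

theorem numFlip_eq_zero_iff : numFlip hk f = 0 ↔ ∀ i, f i ≠ (i.castLE hk).rev := by
  rw [numFlip, Finset.card_eq_zero, Finset.filter_eq_empty_iff]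
  simp only [Finset.mem_univ, true_imp_iff, ne_eq]

theorem eq_castLE_of_counts (ha : numMid hk f = 0) (hb : numFlip hk f = 0) :
    f = Fin.castLE hk :=
  funext fun i => (numMid_eq_zero_iff.1 ha i).resolve_right (numFlip_eq_zero_iff.1 hb i)

theorem exists_mid (h : numMid hk f ≠ 0) :
    ∃ i, f i ≠ i.castLE hk ∧ f i ≠ (i.castLE hk).rev := by
  obtain ⟨i, hi⟩ := Finset.card_ne_zero.1 h
  exact ⟨i, by simpa using hi⟩

theorem exists_flip (h : numFlip hk f ≠ 0) : ∃ i, f i = (i.castLE hk).rev := by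
  obtain ⟨i, hi⟩ := Finset.card_ne_zero.1 h
  exact ⟨i, by simpa using hi⟩

theorem exists_two_flips (h : 2 ≤ numFlip hk f) :
    ∃ i j, i ≠ j ∧ f i = (i.castLE hk).rev ∧ f j = (j.castLE hk).rev := by
  obtain ⟨i, hi, j, hj, hij⟩ := Finset.one_lt_card.1 h
  exact ⟨i, j, hij, by simpa using hi, by simpa using hj⟩

/-- Every admissible tuple is reached from the initial one by elementary moves; the cost is counted
by the numbers of moved and flipped indices. -/
theorem Admissible.induction (hkn : k < n) {P : (Fin k → Fin (2 * n)) → ℕ → Prop}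
    (base : P (Fin.castLE hk) 0)
    (mid : ∀ f i s, Admissible hk f → f i ≠ i.castLE hk → f i ≠ (i.castLE hk).rev →
      P (reset hk f i) s → P f (s + 1))
    (pair : ∀ f i j s, Admissible hk f → i ≠ j → f i = (i.castLE hk).rev →
      f j = (j.castLE hk).rev → P (reset hk (reset hk f i) j) s → P f (s + 2))
    (mixed : ∀ f i j s, Admissible hk f → i ≠ j → f i = (i.castLE hk).rev → f j ≠ j.castLE hk →
      f j ≠ (j.castLE hk).rev → P (reset hk (reset hk f i) j) s → P f (s + 2))
    (flip : ∀ f i, Admissible hk f → f i = (i.castLE hk).rev →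
      reset hk f i = Fin.castLE hk → P f 2)
    (hf : Admissible hk f) :
    P f (numMid hk f + numFlip hk f + if numMid hk f = 0 ∧ Odd (numFlip hk f) then 1 else 0) := by
  induction hm : numMid hk f + numFlip hk f using Nat.strong_induction_on generalizing f with
  | _ m ih =>
  subst hm
  -- Flips are removed in pairs, which preserves both the parity of their number and `numMid`. A
  -- last flip is paired with a middle entry if there is one; otherwise it costs the extra unit.
  rcases Nat.lt_or_ge (numFlip hk f) 2 with hb | hb
  · rcases Nat.eq_zero_or_pos (numFlip hk f) with hb0 | hb0
    · rcases Nat.eq_zero_or_pos (numMid hk f) with ha0 | ha0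
      · rw [ha0, hb0, eq_castLE_of_counts ha0 hb0]; exact base
      · obtain ⟨i, h1, h2⟩ := exists_mid ha0.ne'
        have e1 := numMid_reset (hk := hk) (f := f) i
        have e2 := numFlip_reset (hk := hk) (f := f) hkn i
        rw [if_pos ⟨h1, h2⟩] at e1
        rw [if_neg h2] at e2
        have := mid f i _ hf h1 h2 (ih _ (by omega) (hf.resetAt hkn i) rfl)
        convert this using 1
        rw [e1, e2, hb0, if_neg (by simp), if_neg (by simp)]
        omega
    · have hb1 : numFlip hk f = 1 := by omega
      obtain ⟨i, h1⟩ := exists_flip hb0.ne'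
      have h1' : ¬(f i ≠ i.castLE hk ∧ f i ≠ (i.castLE hk).rev) := fun h => h.2 h1
      have e1 := numMid_reset (hk := hk) (f := f) i
      have e2 := numFlip_reset (hk := hk) (f := f) hkn i
      rw [if_neg h1'] at e1
      rw [if_pos h1] at e2
      rcases Nat.eq_zero_or_pos (numMid hk f) with ha0 | ha0
      · rw [ha0, hb1]
        exact flip f i hf h1 (eq_castLE_of_counts (by omega) (by omega))
      · obtain ⟨j, h2, h3⟩ := exists_mid ha0.ne'
        have hij : i ≠ j := by rintro rfl; exact h3 h1
        have e3 := numMid_reset (hk := hk) (f := reset hk f i) j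
        have e4 := numFlip_reset (hk := hk) (f := reset hk f i) hkn j
        rw [reset_of_ne hij.symm, if_pos ⟨h2, h3⟩] at e3
        rw [reset_of_ne hij.symm, if_neg h3] at e4
        have := mixed f i j _ hf hij h1 h2 h3
          (ih _ (by omega) ((hf.resetAt hkn i).resetAt hkn j) rfl)
        convert this using 1
        have e5 : numFlip hk (reset hk (reset hk f i) j) = 0 := by omega
        rw [e5, if_neg (by omega), if_neg (by simp)]
        omega
  · obtain ⟨i, j, hij, h1, h2⟩ := exists_two_flips hb
    have h1' : ¬(f i ≠ i.castLE hk ∧ f i ≠ (i.castLE hk).rev) := fun h => h.2 h1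
    have h2' : ¬(f j ≠ j.castLE hk ∧ f j ≠ (j.castLE hk).rev) := fun h => h.2 h2
    have e1 := numMid_reset (hk := hk) (f := f) i
    have e2 := numFlip_reset (hk := hk) (f := f) hkn i
    have e3 := numMid_reset (hk := hk) (f := reset hk f i) j
    have e4 := numFlip_reset (hk := hk) (f := reset hk f i) hkn j
    rw [if_neg h1'] at e1
    rw [if_pos h1] at e2
    rw [reset_of_ne hij.symm, if_neg h2'] at e3
    rw [reset_of_ne hij.symm, if_pos h2] at e4
    have := pair f i j _ hf hij h1 h2 (ih _ (by omega) ((hf.resetAt hkn i).resetAt hkn j) rfl)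
    convert this using 1
    have e5 : numFlip hk f = numFlip hk (reset hk (reset hk f i) j) + 2 := by omega
    have e6 : numMid hk (reset hk (reset hk f i) j) = numMid hk f := by omega
    rw [e6, e5]
    simp only [Nat.odd_add, even_two, iff_true]
    omega

end

end TypeD

/-! ### Upper bounds for the PBW degree by root operators -/

theorem PBW.apply_mem_filtration {L M : Type*} [LieRing L] [LieAlgebra ℂ L] [AddCommGroup M]
    [Module ℂ M] {ρ : L →ₗ⁅ℂ⁆ Module.End ℂ M} {N : LieSubalgebra ℂ L} {v₀ u : M} {s : ℕ} {x : L}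
    (hx : x ∈ N) (hu : u ∈ PBW.filtration ρ N v₀ s) : ρ x u ∈ PBW.filtration ρ N v₀ (s + 1) := by
  induction hu using Submodule.span_induction with
  | mem u hu =>
    obtain ⟨xs, h1, h2, rfl⟩ := hu
    refine Submodule.subset_span ⟨x :: xs, ?_, by simpa using h2, by simp⟩
    simpa using ⟨hx, h1⟩
  | zero => simp
  | add u v _ _ hu hv => rw [map_add]; exact add_mem hu hv
  | smul a u _ hu => rw [map_smul]; exact Submodule.smul_mem _ _ hu

namespace TypeD

open ExtPow

variable {n k : ℕ}

theorem mem_so_iff {X : Matrix (Fin (2 * n)) (Fin (2 * n)) ℂ} :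
    X ∈ so n ↔ ∀ a b, X b.rev a = -X a.rev b := by
  rw [so, mem_skewAdjointMatricesLieSubalgebra, mem_skewAdjointMatricesSubmodule,
    Matrix.IsSkewAdjoint, Matrix.IsAdjointPair, ← Matrix.ext_iff]
  refine forall₂_congr fun a b => ?_
  have h1 : (X.transpose * form n) a b = X b.rev a := by
    simp [Matrix.mul_apply, form, ← Fin.rev_eq_iff]
  have h2 : (form n * -X) a b = -X a.rev b := by
    simp [Matrix.mul_apply, form]
  rw [h1, h2]

theorem extRep_apply (x : so n) :
    extRep n k x = act k (Matrix.toLin' x.1) := rfl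

/-- The root operator `e_j ↦ e_m`, `e_{m'} ↦ -e_{j'}`, where `'` is the opposite index. -/
def lowerOp (j m : Fin (2 * n)) : so n :=
  ⟨.of fun a b => (if a = m ∧ b = j then 1 else 0) - if a = j.rev ∧ b = m.rev then 1 else 0, by
    rw [mem_so_iff]
    intro a b
    simp only [Matrix.of_apply, Fin.rev_eq_iff, Fin.rev_rev, neg_sub]
    simp only [and_comm]⟩

theorem lowerOp_mem {j m : Fin (2 * n)} (h : j < m) : lowerOp j m ∈ nMinus n := by
  intro a b hab
  simp only [lowerOp, Matrix.of_apply]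
  rw [if_neg, if_neg, sub_zero]
  · rintro ⟨rfl, rfl⟩
    exact absurd (Fin.rev_le_rev.1 hab) (not_le.2 h)
  · rintro ⟨rfl, rfl⟩
    exact absurd hab (not_le.2 h)

theorem lowerOp_wedge (j m : Fin (2 * n)) (g : Fin k → Fin (2 * n)) :
    extRep n k (lowerOp j m) (wedge g) =
      ∑ l, (if g l = j then wedge (Function.update g l m) else 0) -
        ∑ l, if g l = m.rev then wedge (Function.update g l j.rev) else 0 := by
  rw [extRep_apply, act_toLin'_wedge, ← Finset.sum_sub_distrib]
  refine Finset.sum_congr rfl fun l _ => ?_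
  simp only [lowerOp, Matrix.of_apply]
  rw [Finset.sum_congr rfl fun m' _ => sub_smul _ _ (wedge (Function.update g l m')),
    Finset.sum_sub_distrib]
  simp only [ite_smul, one_smul, zero_smul, ite_and, Finset.sum_ite_eq', Finset.mem_univ, if_true]

theorem sum_ite_apply_eq {ι κ A : Type*} [Fintype ι] [DecidableEq κ] [AddCommMonoid A]
    {g : ι → κ} {i : ι} {c : κ} (hi : g i = c) (h : ∀ l, g l = c → l = i) (F : ι → A) :
    (∑ l, if g l = c then F l else 0) = F i := by
  rw [Finset.sum_eq_single i (fun l _ hl => if_neg fun e => hl (h l e)) (by simp), if_pos hi]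

theorem sum_ite_apply_ne {ι κ A : Type*} [Fintype ι] [DecidableEq κ] [AddCommMonoid A]
    {g : ι → κ} {c : κ} (h : ∀ l, g l ≠ c) (F : ι → A) :
    (∑ l, if g l = c then F l else 0) = 0 :=
  Finset.sum_eq_zero fun l _ => if_neg (h l)

section
variable {hk : k ≤ 2 * n} {f : Fin k → Fin (2 * n)}

/-- One root operator sends `e_i` to `e_{f i}`. Its other half acts on the vector opposite to `e_{f
i}`, which does not occur because the tuple is isotropic. -/
theorem wedge_mem_of_mid (hkn : k < n) {i : Fin k} {s : ℕ} (hf : Admissible hk f)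
    (h1 : f i ≠ i.castLE hk) (h2 : f i ≠ (i.castLE hk).rev)
    (h : wedge (reset hk f i) ∈ PBW.filtration (extRep n k) (nMinus n) (highestVector hk) s) :
    wedge f ∈ PBW.filtration (extRep n k) (nMinus n) (highestVector hk) (s + 1) := by
  have hlt : i.castLE hk < f i := by
    have := hf.mem i
    have := i.2
    simp only [Fin.lt_def, Fin.ext_iff, Fin.val_rev, Fin.val_castLE, ne_eq] at *
    omega
  have key : extRep n k (lowerOp (i.castLE hk) (f i)) (wedge (reset hk f i)) = wedge f := by
    rw [lowerOp_wedge, sum_ite_apply_eq (reset_self i)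
      fun l hl => (hf.resetAt hkn i).eq_of_apply_eq hkn hl, sum_ite_apply_ne, sub_zero]
    · simp [reset]
    · intro l hl
      rcases eq_or_ne l i with rfl | hli
      · rw [reset_self, ← Fin.rev_eq_iff] at hl
        exact h2 hl.symm
      · rw [reset_of_ne hli] at hl
        exact hf.iso _ _ hl
  rw [← key]
  exact PBW.apply_mem_filtration (lowerOp_mem hlt) h

/-- The operator for `ε_i + ε_j` sends `e_i` to `e_{j'}` and `e_j` to `-e_{i'}`. Applied twice, it
makes both replacements in either order; the two orders contribute equally, giving twice the target.
-/
theorem wedge_mem_of_pair (hkn : k < n) {i j : Fin k} {s : ℕ} (hf : Admissible hk f) (hij : i ≠ j)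
    (hi : f i = (i.castLE hk).rev) (hj : f j = (j.castLE hk).rev)
    (h : wedge (reset hk (reset hk f i) j) ∈
      PBW.filtration (extRep n k) (nMinus n) (highestVector hk) s) :
    wedge f ∈ PBW.filtration (extRep n k) (nMinus n) (highestVector hk) (s + 2) := by
  set g := reset hk (reset hk f i) j with hg
  have ag : Admissible hk g := (hf.resetAt hkn i).resetAt hkn j
  have gi : g i = i.castLE hk := by rw [hg, reset_of_ne hij, reset_self]
  have gj : g j = j.castLE hk := reset_self j
  have hlt : i.castLE hk < (j.castLE hk).rev := by
    have := i.2
    simp only [Fin.lt_def, Fin.val_rev, Fin.val_castLE]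
    omega
  have hne := castLE_ne_rev (hk := hk) hkn
  have hinj : ∀ {a b : Fin k}, a ≠ b → Fin.castLE hk a ≠ Fin.castLE hk b :=
    fun h e => h (Fin.castLE_injective hk e)
  set u := Function.update (Function.update g i (j.castLE hk).rev) j (i.castLE hk).rev with hu
  have e1 : extRep n k (lowerOp (i.castLE hk) (j.castLE hk).rev) (wedge g) =
      wedge (Function.update g i (j.castLE hk).rev) -
        wedge (Function.update g j (i.castLE hk).rev) := by
    rw [lowerOp_wedge, Fin.rev_rev, sum_ite_apply_eq gi fun l hl => ag.eq_of_apply_eq hkn hl,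
      sum_ite_apply_eq gj fun l hl => ag.eq_of_apply_eq hkn hl]
  have e2 : extRep n k (lowerOp (i.castLE hk) (j.castLE hk).rev)
      (wedge (Function.update g i (j.castLE hk).rev)) = -wedge u := by
    rw [lowerOp_wedge, Fin.rev_rev, sum_ite_apply_ne, sum_ite_apply_eq (i := j), zero_sub]
    · rw [Function.update_of_ne hij.symm, gj]
    · intro l hl
      rcases eq_or_ne l i with rfl | hli
      · rw [Function.update_self] at hl
        exact absurd hl.symm (hne _ _)
      · rw [Function.update_of_ne hli] at hl
        exact ag.eq_of_apply_eq hkn hl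
    · intro l hl
      rcases eq_or_ne l i with rfl | hli
      · rw [Function.update_self] at hl
        exact absurd hl.symm (hne _ _)
      · rw [Function.update_of_ne hli] at hl
        exact hli (ag.eq_of_apply_eq hkn hl)
  have e3 : extRep n k (lowerOp (i.castLE hk) (j.castLE hk).rev)
      (wedge (Function.update g j (i.castLE hk).rev)) = wedge u := by
    rw [lowerOp_wedge, Fin.rev_rev, sum_ite_apply_eq (i := i), sum_ite_apply_ne, sub_zero,
      Function.update_comm hij.symm]
    · intro l hl
      rcases eq_or_ne l j with rfl | hli
      · rw [Function.update_self] at hl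
        exact absurd hl.symm (hne _ _)
      · rw [Function.update_of_ne hli] at hl
        exact hli (ag.eq_of_apply_eq hkn hl)
    · rw [Function.update_of_ne hij, gi]
    · intro l hl
      rcases eq_or_ne l j with rfl | hli
      · rw [Function.update_self] at hl
        exact absurd hl.symm (hne _ _)
      · rw [Function.update_of_ne hli] at hl
        exact ag.eq_of_apply_eq hkn hl
  have e4 : u = f ∘ Equiv.swap i j := by
    funext l
    rcases eq_or_ne l i with rfl | hli
    · simp [hu, hij, hj]
    · rcases eq_or_ne l j with rfl | hlj
      · simp [hu, hi]
      · simp [hu, hg, reset, hli, hlj, Equiv.swap_apply_of_ne_of_ne hli hlj]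
  have e5 : wedge f = (2⁻¹ : ℂ) • extRep n k (lowerOp (i.castLE hk) (j.castLE hk).rev)
      (extRep n k (lowerOp (i.castLE hk) (j.castLE hk).rev) (wedge g)) := by
    rw [e1, map_sub, e2, e3, e4, wedge_comp_swap f hij, neg_neg, sub_neg_eq_add, ← two_smul ℂ,
      smul_smul, inv_mul_cancel₀ two_ne_zero, one_smul]
  rw [e5]
  exact Submodule.smul_mem _ _ (PBW.apply_mem_filtration (lowerOp_mem hlt)
    (PBW.apply_mem_filtration (lowerOp_mem hlt) h))

/-- The operator for `ε_i + ε_j` yields two terms. The second operator, sending `e_i` to `e_{f j}`,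
kills the one in which `e_i` has been replaced and turns the other into the target with positions
`i` and `j` exchanged. -/
theorem wedge_mem_of_mixed (hkn : k < n) {i j : Fin k} {s : ℕ} (hf : Admissible hk f) (hij : i ≠ j)
    (hi : f i = (i.castLE hk).rev) (hj1 : f j ≠ j.castLE hk) (hj2 : f j ≠ (j.castLE hk).rev)
    (h : wedge (reset hk (reset hk f i) j) ∈
      PBW.filtration (extRep n k) (nMinus n) (highestVector hk) s) :
    wedge f ∈ PBW.filtration (extRep n k) (nMinus n) (highestVector hk) (s + 2) := by
  set g := reset hk (reset hk f i) j with hg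
  have ag : Admissible hk g := (hf.resetAt hkn i).resetAt hkn j
  have gi : g i = i.castLE hk := by rw [hg, reset_of_ne hij, reset_self]
  have gj : g j = j.castLE hk := reset_self j
  have hlt : j.castLE hk < (i.castLE hk).rev := by
    have := i.2
    simp only [Fin.lt_def, Fin.val_rev, Fin.val_castLE]
    omega
  have hmid : k ≤ (f j : ℕ) ∧ k ≤ ((f j).rev : ℕ) := by
    have := hf.mem j
    tauto
  have hlt' : i.castLE hk < f j := by
    have := i.2
    simp only [Fin.lt_def, Fin.val_castLE]
    omega
  have hmidrev : ∀ a : Fin k, Fin.castLE hk a ≠ (f j).rev := by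
    intro a e
    have := a.2
    rw [← e] at hmid
    simp only [Fin.val_castLE] at hmid
    omega
  have hmidrev' : ∀ a : Fin k, (Fin.castLE hk a).rev ≠ (f j).rev := by
    intro a e
    have := a.2
    rw [Fin.rev_inj] at e
    rw [← e] at hmid
    simp only [Fin.val_castLE] at hmid
    omega
  have hgrev : ∀ l, g l ≠ (f j).rev := by
    intro l e
    rcases eq_or_ne l j with rfl | hlj
    · rw [gj] at e; exact hmidrev _ e
    · rcases eq_or_ne l i with rfl | hli
      · rw [gi] at e; exact hmidrev _ e
      · rw [hg, reset_of_ne hlj, reset_of_ne hli] at e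
        exact hf.iso _ _ e
  have hne := castLE_ne_rev (hk := hk) hkn
  set u := Function.update (Function.update g j (i.castLE hk).rev) i (f j) with hu
  have e1 : extRep n k (lowerOp (j.castLE hk) (i.castLE hk).rev) (wedge g) =
      wedge (Function.update g j (i.castLE hk).rev) -
        wedge (Function.update g i (j.castLE hk).rev) := by
    rw [lowerOp_wedge, Fin.rev_rev, sum_ite_apply_eq gj fun l hl => ag.eq_of_apply_eq hkn hl,
      sum_ite_apply_eq gi fun l hl => ag.eq_of_apply_eq hkn hl]
  have e2 : extRep n k (lowerOp (i.castLE hk) (f j))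
      (wedge (Function.update g j (i.castLE hk).rev)) = wedge u := by
    rw [lowerOp_wedge, sum_ite_apply_eq (i := i), sum_ite_apply_ne, sub_zero]
    · intro l
      rcases eq_or_ne l j with rfl | hlj
      · rw [Function.update_self]; exact hmidrev' _
      · rw [Function.update_of_ne hlj]; exact hgrev l
    · rw [Function.update_of_ne hij, gi]
    · intro l hl
      rcases eq_or_ne l j with rfl | hlj
      · rw [Function.update_self] at hl
        exact absurd hl.symm (hne _ _)
      · rw [Function.update_of_ne hlj] at hl
        exact ag.eq_of_apply_eq hkn hl
  have e3 : extRep n k (lowerOp (i.castLE hk) (f j))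
      (wedge (Function.update g i (j.castLE hk).rev)) = 0 := by
    rw [lowerOp_wedge, sum_ite_apply_ne, sum_ite_apply_ne, sub_zero]
    · intro l
      rcases eq_or_ne l i with rfl | hli
      · rw [Function.update_self]; exact hmidrev' _
      · rw [Function.update_of_ne hli]; exact hgrev l
    · intro l hl
      rcases eq_or_ne l i with rfl | hli
      · rw [Function.update_self] at hl
        exact absurd hl.symm (hne _ _)
      · rw [Function.update_of_ne hli] at hl
        exact hli (ag.eq_of_apply_eq hkn hl)
  have e4 : u = f ∘ Equiv.swap i j := by
    funext l
    rcases eq_or_ne l i with rfl | hli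
    · simp [hu]
    · rcases eq_or_ne l j with rfl | hlj
      · simp [hu, hi, hli]
      · simp [hu, hg, reset, hli, hlj, Equiv.swap_apply_of_ne_of_ne hli hlj]
  have e5 : wedge f = -extRep n k (lowerOp (i.castLE hk) (f j))
      (extRep n k (lowerOp (j.castLE hk) (i.castLE hk).rev) (wedge g)) := by
    rw [e1, map_sub, e2, e3, e4, wedge_comp_swap f hij, sub_zero, neg_neg]
  rw [e5]
  exact Submodule.neg_mem _ (PBW.apply_mem_filtration (lowerOp_mem hlt')
    (PBW.apply_mem_filtration (lowerOp_mem hlt) h))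

theorem wedge_mem_of_flip (hkn : k < n) {i : Fin k} (hi : f i = (i.castLE hk).rev)
    (h : reset hk f i = Fin.castLE hk) :
    wedge f ∈ PBW.filtration (extRep n k) (nMinus n) (highestVector hk) 2 := by
  -- The 0-based index `k` lies in the middle range because `k < n`; the flip goes from `i` through
  -- it to `i'`.
  obtain ⟨m, hm⟩ : ∃ m : Fin (2 * n), (m : ℕ) = k := ⟨⟨k, by omega⟩, rfl⟩
  have hlt1 : i.castLE hk < m := by
    have := i.2
    simp only [Fin.lt_def, Fin.val_castLE]; omega
  have hlt2 : m < (i.castLE hk).rev := by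
    have := i.2
    simp only [Fin.lt_def, Fin.val_castLE, Fin.val_rev]; omega
  have hne := castLE_ne_rev (hk := hk) hkn
  have hm1 : ∀ l : Fin k, l.castLE hk ≠ m := by
    intro l e
    have := l.2
    simp only [Fin.ext_iff, Fin.val_castLE] at e; omega
  have hm2 : ∀ l : Fin k, l.castLE hk ≠ m.rev := by
    intro l e
    have := l.2
    simp only [Fin.ext_iff, Fin.val_castLE, Fin.val_rev] at e; omega
  have e1 : extRep n k (lowerOp (i.castLE hk) m) (wedge (Fin.castLE hk)) =
      wedge (Function.update (Fin.castLE hk) i m) := by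
    rw [lowerOp_wedge, sum_ite_apply_eq rfl fun l hl => Fin.castLE_injective hk hl,
      sum_ite_apply_ne hm2, sub_zero]
  have e2 : extRep n k (lowerOp m (i.castLE hk).rev)
      (wedge (Function.update (Fin.castLE hk) i m)) = wedge f := by
    rw [lowerOp_wedge, Fin.rev_rev, sum_ite_apply_eq (i := i), sum_ite_apply_ne, sub_zero, ← h]
    · rw [h, ← hi, ← h, reset, Function.update_idem, Function.update_idem, Function.update_eq_self]
    · intro l hl
      rcases eq_or_ne l i with rfl | hli
      · rw [Function.update_self] at hl; exact hm1 _ hl.symm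
      · rw [Function.update_of_ne hli] at hl; exact hli (Fin.castLE_injective hk hl)
    · rw [Function.update_self]
    · intro l hl
      by_contra hli
      rw [Function.update_of_ne hli] at hl; exact hm1 _ hl
  rw [← e2, ← e1]
  refine PBW.apply_mem_filtration (lowerOp_mem hlt2) (PBW.apply_mem_filtration (s := 0)
    (lowerOp_mem hlt1) (Submodule.subset_span ⟨[], by simp, by simp, by simp; rfl⟩))

theorem wedge_mem_filtration (hkn : k < n) (hf : Admissible hk f) :
    wedge f ∈ PBW.filtration (extRep n k) (nMinus n) (highestVector hk)
      (numMid hk f + numFlip hk f + if numMid hk f = 0 ∧ Odd (numFlip hk f) then 1 else 0) :=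
  hf.induction hkn
    (P := fun f s => wedge f ∈ PBW.filtration (extRep n k) (nMinus n) (highestVector hk) s)
    (Submodule.subset_span ⟨[], by simp, by simp, by simp; rfl⟩)
    (fun _ _ _ => wedge_mem_of_mid hkn)
    (fun _ _ _ _ => wedge_mem_of_pair hkn)
    (fun _ _ _ _ => wedge_mem_of_mixed hkn)
    (fun _ _ _ => wedge_mem_of_flip hkn)

end

end TypeD

namespace TypeD

open ExtPow

variable {n k : ℕ}

/-! ### Weights of tuples -/

/-- The weight of the basis vector `e_m`. -/
def wt (m : Fin (2 * n)) : Fin n → ℤ := fun c =>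
  (if m = c.castLE (by omega) then 1 else 0) - if m = (c.castLE (by omega)).rev then 1 else 0

/-- The weight of `wedge g`. -/
def tupleWeight (g : Fin k → Fin (2 * n)) : Fin n → ℤ := ∑ l, wt (g l)

theorem wt_rev (m : Fin (2 * n)) : wt m.rev = -wt m := by
  funext c
  simp only [wt, Pi.neg_apply, Fin.rev_eq_iff, Fin.rev_rev, neg_sub]

theorem castLE_two_mul_ne_rev (a b : Fin n) (h : n ≤ 2 * n) : a.castLE h ≠ (b.castLE h).rev := by
  simp only [ne_eq, Fin.ext_iff, Fin.val_rev, Fin.val_castLE]; omega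

theorem wt_castLE (c : Fin n) (h : n ≤ 2 * n) : wt (c.castLE h) = Pi.single c 1 := by
  funext a
  rw [wt, if_neg (castLE_two_mul_ne_rev _ _ h), sub_zero, Pi.single_apply]
  simp only [Fin.castLE_inj, eq_comm]

theorem exists_eq_castLE_or_rev (m : Fin (2 * n)) (h : n ≤ 2 * n) :
    ∃ c : Fin n, m = c.castLE h ∨ m = (c.castLE h).rev := by
  rcases lt_or_ge (m : ℕ) n with hm | hm
  · exact ⟨⟨m, hm⟩, Or.inl rfl⟩
  · refine ⟨⟨m.rev, ?_⟩, Or.inr ?_⟩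
    · rw [Fin.val_rev]; omega
    · rw [← Fin.rev_eq_iff]; rfl

theorem wt_castLE_of_lt (hkn : k < n) (hk : k ≤ 2 * n) (i : Fin k) :
    wt (i.castLE hk) = Pi.single (i.castLE hkn.le) 1 :=
  wt_castLE (i.castLE hkn.le) (by omega)

theorem tupleWeight_castLE (hkn : k < n) (hk : k ≤ 2 * n) :
    tupleWeight (Fin.castLE hk) = omega n k := by
  funext c
  rw [tupleWeight, Finset.sum_apply, omega]
  simp only [wt_castLE_of_lt hkn]
  split_ifs with h
  · rw [Finset.sum_eq_single ⟨c, h⟩]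
    · exact Pi.single_eq_same (M := fun _ : Fin n => ℤ) c 1
    · intro b _ hb
      refine Pi.single_eq_of_ne ?_ _
      rintro rfl
      exact hb rfl
    · simp
  · refine Finset.sum_eq_zero fun i _ => Pi.single_eq_of_ne ?_ _
    rintro rfl
    exact h i.2

theorem tupleWeight_reset (hk : k ≤ 2 * n) (f : Fin k → Fin (2 * n)) (i : Fin k) :
    tupleWeight f = tupleWeight (reset hk f i) + wt (f i) - wt (i.castLE hk) := by
  rw [tupleWeight, tupleWeight, ← Finset.add_sum_erase _ _ (Finset.mem_univ i),
    ← Finset.add_sum_erase _ (fun l => wt (reset hk f i l)) (Finset.mem_univ i),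
    Finset.sum_congr rfl fun l hl => congrArg wt
      (reset_of_ne (hk := hk) (f := f) (Finset.ne_of_mem_erase hl)), reset_self]
  abel

section
variable {hk : k ≤ 2 * n} {f : Fin k → Fin (2 * n)}

/-! ### Kostant degrees -/

/-- `omega - wt f` is a sum of `s` positive roots. -/
def HasDecomposition (f : Fin k → Fin (2 * n)) (s : ℕ) : Prop :=
  ∃ S : Multiset (Fin n → ℤ), (∀ α ∈ S, α ∈ posRoots n) ∧
    S.sum = omega n k - tupleWeight f ∧ Multiset.card S = s

theorem single_add_single_mem_posRoots {i j : Fin n} (h : i ≠ j) :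
    Pi.single i 1 + Pi.single j 1 ∈ posRoots n := by
  rcases lt_or_gt_of_ne h with h | h
  · exact ⟨i, j, h, Or.inr rfl⟩
  · exact ⟨j, i, h, Or.inr (add_comm _ _)⟩

theorem wt_sub_wt_mem_posRoots (hkn : k < n) (hk : k ≤ 2 * n) (i : Fin k) {m : Fin (2 * n)}
    (h1 : k ≤ (m : ℕ)) (h2 : k ≤ (m.rev : ℕ)) : wt (i.castLE hk) - wt m ∈ posRoots n := by
  obtain ⟨c, hc⟩ := exists_eq_castLE_or_rev m (by omega)
  rcases hc with hc | hc <;> rw [hc] at h1 h2 ⊢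
  · rw [wt_castLE_of_lt hkn, wt_castLE]
    exact ⟨_, c, i.2.trans_le h1, Or.inl rfl⟩
  · rw [wt_castLE_of_lt hkn, wt_rev, wt_castLE, sub_neg_eq_add]
    rw [Fin.rev_rev] at h2
    exact ⟨_, c, i.2.trans_le h2, Or.inr rfl⟩

theorem HasDecomposition.cons {f g : Fin k → Fin (2 * n)} {s : ℕ} (hg : HasDecomposition g s)
    {T : Multiset (Fin n → ℤ)} (hT : ∀ α ∈ T, α ∈ posRoots n)
    (h : tupleWeight g = tupleWeight f + T.sum) : HasDecomposition f (s + Multiset.card T) := by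
  obtain ⟨S, h1, h2, rfl⟩ := hg
  refine ⟨S + T, ?_, ?_, Multiset.card_add _ _⟩
  · intro α hα
    rcases Multiset.mem_add.1 hα with hα | hα
    exacts [h1 α hα, hT α hα]
  · rw [Multiset.sum_add, h2, h]
    abel

theorem hasDecomposition_castLE (hkn : k < n) : HasDecomposition (Fin.castLE hk) 0 :=
  ⟨0, by simp, by simp [tupleWeight_castLE hkn], rfl⟩

theorem hasDecomposition_of_pair (hkn : k < n) {i j : Fin k} {s : ℕ} (hij : i ≠ j)
    (hi : f i = (i.castLE hk).rev) (hj : f j = (j.castLE hk).rev)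
    (h : HasDecomposition (reset hk (reset hk f i) j) s) : HasDecomposition f (s + 2) := by
  have hij' : i.castLE hkn.le ≠ j.castLE hkn.le := fun e => hij (Fin.castLE_injective _ e)
  refine h.cons (T := {Pi.single (i.castLE hkn.le) 1 + Pi.single (j.castLE hkn.le) 1,
    Pi.single (i.castLE hkn.le) 1 + Pi.single (j.castLE hkn.le) 1}) ?_ ?_
  · simp [single_add_single_mem_posRoots hij']
  · rw [tupleWeight_reset hk f i, tupleWeight_reset hk (reset hk f i) j, reset_of_ne hij.symm, hi,
      hj, wt_rev, wt_rev, wt_castLE_of_lt hkn, wt_castLE_of_lt hkn, Multiset.insert_eq_cons,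
      Multiset.sum_cons, Multiset.sum_singleton]
    abel

/-- The same moves as for the PBW degree, with one positive root for each operator. -/
theorem hasDecomposition_of_counts (hkn : k < n) (hf : Admissible hk f) :
    HasDecomposition f (numMid hk f + numFlip hk f +
      if numMid hk f = 0 ∧ Odd (numFlip hk f) then 1 else 0) := by
  refine hf.induction hkn (P := HasDecomposition) (hasDecomposition_castLE hkn) ?_
    (fun f i j s _ => hasDecomposition_of_pair hkn) ?_ ?_
  · intro f i s hf h1 h2 h
    have hm : k ≤ (f i : ℕ) ∧ k ≤ ((f i).rev : ℕ) := by have := hf.mem i; tauto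
    refine h.cons (T := {wt (i.castLE hk) - wt (f i)}) ?_ ?_
    · simp [wt_sub_wt_mem_posRoots hkn hk i hm.1 hm.2]
    · rw [tupleWeight_reset hk f i, Multiset.sum_singleton]
      abel
  · intro f i j s hf hij hi h1 h2 h
    have hm : k ≤ (f j : ℕ) ∧ k ≤ ((f j).rev : ℕ) := by have := hf.mem j; tauto
    have hij' : i.castLE hkn.le ≠ j.castLE hkn.le := fun e => hij (Fin.castLE_injective _ e)
    refine h.cons (T := {wt (i.castLE hk) - wt (f j),
      Pi.single (i.castLE hkn.le) 1 + Pi.single (j.castLE hkn.le) 1}) ?_ ?_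
    · simp [wt_sub_wt_mem_posRoots hkn hk i hm.1 hm.2, single_add_single_mem_posRoots hij']
    · rw [tupleWeight_reset hk f i, tupleWeight_reset hk (reset hk f i) j, reset_of_ne hij.symm, hi,
        wt_rev, wt_castLE_of_lt hkn, wt_castLE_of_lt hkn, Multiset.insert_eq_cons,
        Multiset.sum_cons, Multiset.sum_singleton]
      abel
  · intro f i _ hi h
    have h0 : HasDecomposition (reset hk f i) 0 := by rw [h]; exact hasDecomposition_castLE hkn
    have hlt : i.castLE hkn.le < (⟨k, hkn⟩ : Fin n) := i.2
    -- `2ε_i` is split with the help of the first coordinate beyond the support of `omega n k`.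
    refine zero_add 2 ▸ h0.cons (T := {Pi.single (i.castLE hkn.le) 1 - Pi.single ⟨k, hkn⟩ 1,
      Pi.single (i.castLE hkn.le) 1 + Pi.single ⟨k, hkn⟩ 1}) ?_ ?_
    · simp only [Multiset.insert_eq_cons, Multiset.mem_cons, Multiset.mem_singleton]
      rintro α (rfl | rfl)
      exacts [⟨_, _, hlt, Or.inl rfl⟩, ⟨_, _, hlt, Or.inr rfl⟩]
    · rw [tupleWeight_reset hk f i, hi, wt_rev, wt_castLE_of_lt hkn, Multiset.insert_eq_cons,
        Multiset.sum_cons, Multiset.sum_singleton]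
      abel

/-- Three flips can be made with three roots, although this is impossible with two and one. -/
theorem hasDecomposition_of_three_le (hkn : k < n) (hf : Admissible hk f) (ha : numMid hk f = 0)
    (hb : Odd (numFlip hk f)) (hb3 : 3 ≤ numFlip hk f) :
    HasDecomposition f (numFlip hk f) := by
  obtain ⟨i, j, l, hi, hj, hl, hij, hil, hjl⟩ := Finset.two_lt_card_iff.1 hb3
  simp only [Finset.mem_filter, Finset.mem_univ, true_and] at hi hj hl
  set g := reset hk (reset hk (reset hk f i) j) l with hg
  have e1 := numFlip_reset (hk := hk) (f := f) hkn i
  have e2 := numFlip_reset (hk := hk) (f := reset hk f i) hkn j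
  have e3 := numFlip_reset (hk := hk) (f := reset hk (reset hk f i) j) hkn l
  have m1 := numMid_reset (hk := hk) (f := f) i
  have m2 := numMid_reset (hk := hk) (f := reset hk f i) j
  have m3 := numMid_reset (hk := hk) (f := reset hk (reset hk f i) j) l
  rw [if_pos hi] at e1
  rw [reset_of_ne hij.symm, if_pos hj] at e2
  rw [reset_of_ne hjl.symm, reset_of_ne hil.symm, if_pos hl] at e3
  rw [← hg] at e3 m3
  have hga : numMid hk g = 0 := by omega
  have hgb : numFlip hk f = numFlip hk g + 3 := by omega
  have hd := hasDecomposition_of_counts hkn (((hf.resetAt hkn i).resetAt hkn j).resetAt hkn l)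
  -- An even number of flips remains, so the rest is decomposed without the extra unit.
  have hev : ¬Odd (numFlip hk g) := by
    rw [hgb, Nat.odd_add] at hb
    intro h
    exact absurd (hb.1 h) (by decide)
  rw [if_neg fun h => hev h.2, hga, zero_add, add_zero] at hd
  rw [hgb]
  have inj : ∀ {a b : Fin k}, a ≠ b → a.castLE hkn.le ≠ b.castLE hkn.le :=
    fun h e => h (Fin.castLE_injective _ e)
  refine hd.cons (T := {Pi.single (i.castLE hkn.le) 1 + Pi.single (j.castLE hkn.le) 1,
    Pi.single (i.castLE hkn.le) 1 + Pi.single (l.castLE hkn.le) 1,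
    Pi.single (j.castLE hkn.le) 1 + Pi.single (l.castLE hkn.le) 1}) ?_ ?_
  · simp [single_add_single_mem_posRoots (inj hij), single_add_single_mem_posRoots (inj hil),
      single_add_single_mem_posRoots (inj hjl)]
  · rw [tupleWeight_reset hk f i, tupleWeight_reset hk (reset hk f i) j,
      tupleWeight_reset hk (reset hk (reset hk f i) j) l, reset_of_ne hjl.symm,
      reset_of_ne hil.symm, reset_of_ne hij.symm, hi, hj, hl, wt_rev, wt_rev, wt_rev,
      wt_castLE_of_lt hkn, wt_castLE_of_lt hkn, wt_castLE_of_lt hkn, Multiset.insert_eq_cons,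
      Multiset.insert_eq_cons, Multiset.sum_cons, Multiset.sum_cons, Multiset.sum_singleton]
    abel

/-- An additive functional bounded on the positive roots converts its drop into a lower bound for
the number of roots. -/
theorem HasDecomposition.le {s : ℕ} (h : HasDecomposition f s) (φ : (Fin n → ℤ) →+ ℤ) {c : ℤ}
    (hφ : ∀ α ∈ posRoots n, φ α ≤ c) : φ (omega n k) - φ (tupleWeight f) ≤ s * c := by
  obtain ⟨S, h1, h2, rfl⟩ := h
  rw [← map_sub, ← h2, map_multiset_sum, ← nsmul_eq_mul, ← Multiset.card_map φ S]
  refine Multiset.sum_le_card_nsmul _ _ fun x hx => ?_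
  obtain ⟨α, hα, rfl⟩ := Multiset.mem_map.1 hx
  exact hφ α (h1 α hα)

/-- The pairing with a vector of signs. -/
def signForm (s : Fin n → ℤ) : (Fin n → ℤ) →+ ℤ where
  toFun x := ∑ c, s c * x c
  map_zero' := by simp
  map_add' x y := by simp [mul_add, Finset.sum_add_distrib]

theorem signForm_single (s : Fin n → ℤ) (c : Fin n) : signForm s (Pi.single c 1) = s c := by
  simp [signForm, Pi.single_apply]

theorem HasDecomposition.counts_le (hkn : k < n) (hf : Admissible hk f) {s : ℕ}
    (h : HasDecomposition f s) : numMid hk f + numFlip hk f ≤ s := by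
  classical
  -- The signs are chosen so that every moved or flipped index has value -1 and every original one
  -- value 1. The drop is then `2 (numMid + numFlip)`, while a root contributes at most 2.
  let σ : Fin n → ℤ := fun c =>
    if (∃ l, f l = c.castLE (by omega)) ∧ k ≤ (c : ℕ) then -1 else 1
  have hσ : ∀ c, -1 ≤ σ c ∧ σ c ≤ 1 := fun c => by
    simp only [σ]; split_ifs <;> simp
  have h1 := h.le (signForm σ) (c := 2) (by
    rintro _ ⟨i, j, -, rfl | rfl⟩
    · rw [map_sub, signForm_single, signForm_single]; linarith [hσ i, hσ j]
    · rw [map_add, signForm_single, signForm_single]; linarith [hσ i, hσ j])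
  have hlo : ∀ l : Fin k, signForm σ (wt (l.castLE hk)) = 1 := fun l => by
    rw [wt_castLE_of_lt hkn, signForm_single]
    simp only [σ]
    rw [if_neg]
    rintro ⟨-, h⟩
    exact absurd l.2 (not_lt.2 h)
  have h2 : ∀ l, signForm σ (wt (l.castLE hk)) - signForm σ (wt (f l)) =
      2 * ((if f l ≠ l.castLE hk ∧ f l ≠ (l.castLE hk).rev then 1 else 0) +
        if f l = (l.castLE hk).rev then 1 else 0) := by
    intro l
    rw [hlo]
    rcases hf.mem l with e | e | e
    · rw [if_neg fun h => h.1 e, if_neg fun h => castLE_ne_rev hkn _ _ (e.symm.trans h), e, hlo]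
      norm_num
    · rw [if_neg fun h => h.2 e, if_pos e, e, wt_rev, map_neg, hlo]
      norm_num
    · rw [if_pos, if_neg]
      · obtain ⟨c, hc⟩ := exists_eq_castLE_or_rev (f l) (by omega)
        rcases hc with hc | hc
        · rw [hc, wt_castLE, signForm_single]
          simp only [σ]
          rw [if_pos ⟨⟨l, hc⟩, by rw [hc] at e; exact e.1⟩]
          norm_num
        · rw [hc, wt_rev, wt_castLE, map_neg, signForm_single]
          simp only [σ]
          rw [if_neg]
          · norm_num
          · rintro ⟨⟨l', hl'⟩, -⟩
            rw [← hl'] at hc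
            exact hf.iso _ _ hc
      · intro h
        rw [h, Fin.rev_rev] at e
        exact absurd l.2 (not_lt.2 e.2)
      · refine ⟨fun h => ?_, fun h => ?_⟩
        · rw [h] at e
          exact absurd l.2 (not_lt.2 e.1)
        · rw [h, Fin.rev_rev] at e
          exact absurd l.2 (not_lt.2 e.2)
  rw [← tupleWeight_castLE hkn hk, tupleWeight, tupleWeight, map_sum, map_sum,
    ← Finset.sum_sub_distrib, Finset.sum_congr rfl fun l _ => h2 l, ← Finset.mul_sum,
    Finset.sum_add_distrib, Finset.sum_boole, Finset.sum_boole] at h1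
  rw [numMid, numFlip]
  omega

/-- A flipped coordinate drops from 1 to -1, and each positive root has coordinates at most 1. -/
theorem HasDecomposition.two_le (hkn : k < n) (hf : Admissible hk f) {s : ℕ}
    (h : HasDecomposition f s) (hb : numFlip hk f ≠ 0) : 2 ≤ s := by
  obtain ⟨i, hi⟩ := exists_flip hb
  have h1 := h.le (Pi.evalAddMonoidHom (fun _ : Fin n => ℤ) (i.castLE hkn.le)) (c := 1) (by
    rintro _ ⟨a, b, hab, rfl | rfl⟩ <;>
    simp only [Pi.evalAddMonoidHom_apply, Pi.sub_apply, Pi.add_apply, Pi.single_apply] <;>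
    split_ifs <;> omega)
  have h2 : tupleWeight f (i.castLE hkn.le) = -1 := by
    rw [tupleWeight, Finset.sum_apply, Finset.sum_eq_single i]
    · rw [hi, wt_rev, wt_castLE_of_lt hkn, Pi.neg_apply, Pi.single_eq_same]
    · intro l _ hl
      exact (congrArg₂ _ (if_neg fun e => hl (hf.eq_of_apply_eq hkn e))
        (if_neg fun e => hl (hf.eq_of_apply_eq_rev hkn e))).trans (sub_zero _)
    · simp
  have h3 : omega n k (i.castLE hkn.le) = 1 := if_pos i.2
  simp only [Pi.evalAddMonoidHom_apply, h2, h3] at h1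
  omega

/-- The three-root move absorbs the parity defect as soon as three flips are available, so only an
isolated single flip costs extra. -/
theorem isLeast_hasDecomposition (hkn : k < n) (hf : Admissible hk f) :
    IsLeast {s | HasDecomposition f s}
      (numMid hk f + numFlip hk f + if numMid hk f = 0 ∧ numFlip hk f = 1 then 1 else 0) := by
  refine ⟨?_, fun s hs => ?_⟩
  · have h1 := hasDecomposition_of_counts hkn hf
    by_cases h : numMid hk f = 0 ∧ Odd (numFlip hk f)
    · rcases Nat.lt_or_ge (numFlip hk f) 3 with h3 | h3
      · have h4 : numFlip hk f = 1 := by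
          obtain ⟨m, hm⟩ := h.2
          omega
        rw [if_pos h] at h1
        rwa [if_pos ⟨h.1, h4⟩]
      · rw [if_neg (by omega), h.1, zero_add, add_zero]
        exact hasDecomposition_of_three_le hkn hf h.1 h.2 h3
    · rw [if_neg h] at h1
      rwa [if_neg]
      rintro ⟨h2, h3⟩
      exact h ⟨h2, by rw [h3]; exact odd_one⟩
  · have h1 := hs.counts_le hkn hf
    split_ifs with h
    · have := hs.two_le hkn hf (by omega)
      omega
    · omega

end

end TypeD

/-! ### Lower bounds for the PBW degree -/

namespace TypeD

open ExtPow

variable {n k : ℕ} {hk : k ≤ 2 * n} {f : Fin k → Fin (2 * n)}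

theorem highestVector_eq_wedge (hk : k ≤ 2 * n) :
    highestVector hk = wedge (Fin.castLE hk) := rfl

/-- The height counts the indices outside the first `k`. It starts at 0, and an operator changes one
index at a time. -/
theorem filtration_le_heightFiltration (hk : k ≤ 2 * n) (s : ℕ) :
    PBW.filtration (extRep n k) (nMinus n) (highestVector hk) s ≤
      heightFiltration k (fun m : Fin (2 * n) => if (m : ℕ) < k then 0 else 1) s := by
  refine Submodule.span_le.2 ?_
  rintro _ ⟨xs, -, hs, rfl⟩
  refine heightFiltration_mono _ (Int.ofNat_le.2 hs) ?_
  clear hs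
  induction xs with
  | nil =>
    refine wedge_mem_heightFiltration (g := Fin.castLE hk) ?_
    simp
  | cons x xs ih =>
    rw [List.map_cons, List.prod_cons, Module.End.mul_apply, extRep_apply, List.length_cons,
      Nat.cast_succ]
    refine act_mem_heightFiltration (fun m j _ => ?_) ih
    split_ifs <;> norm_num

theorem counts_le_of_mem_filtration (hkn : k < n) (hf : Admissible hk f) {s : ℕ}
    (h : wedge f ∈ PBW.filtration (extRep n k) (nMinus n) (highestVector hk) s) :
    numMid hk f + numFlip hk f ≤ s := by
  by_contra hlt
  have h1 : ∑ l, (if (f l : ℕ) < k then (0 : ℤ) else 1) = (numMid hk f + numFlip hk f : ℕ) := by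
    rw [numMid, numFlip, Nat.cast_add, ← Finset.sum_boole, ← Finset.sum_boole,
      ← Finset.sum_add_distrib]
    refine Finset.sum_congr rfl fun l _ => ?_
    have h2 := hf.mem l
    have h3 := l.2
    simp only [Fin.ext_iff, Fin.val_rev, Fin.val_castLE, ne_eq] at h2 ⊢
    split_ifs <;> omega
  have h2 := coeff_eq_zero_of_mem_heightFiltration (f := f) (by rw [h1]; omega)
    (filtration_le_heightFiltration hk s h)
  rw [coeff_wedge_self hf.inj] at h2
  exact one_ne_zero h2

/-! ### Odd numbers of flips -/

section Odd

variable (P : Fin (2 * n) → Prop) [DecidablePred P]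

/-- The part of `X` which maps the basis vectors with index in `P` to the opposite ones. -/
def flipPart (X : Matrix (Fin (2 * n)) (Fin (2 * n)) ℂ) : Matrix (Fin (2 * n)) (Fin (2 * n)) ℂ :=
  .of fun a b => if P b ∧ P a.rev then X a b else 0

/-- The opposite index for indices in `P` and their opposites. -/
def flipIndex (m : Fin (2 * n)) : Fin (2 * n) := if P m ∨ P m.rev then m.rev else m

/-- The height with value `-1` on `P` and `1` on the opposite of `P`. -/
def flipHeight (m : Fin (2 * n)) : ℤ := if P m then -1 else if P m.rev then 1 else 0

/-- The bilinear form which pairs `e_m` with the basis vector of index `flipIndex P m`. -/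
noncomputable def flipForm :
    (Fin (2 * n) → ℂ) →ₗ[ℂ] Module.Dual ℂ (Fin (2 * n) → ℂ) :=
  LinearMap.mk₂ ℂ (fun u v => ∑ m, u m * v (flipIndex P m))
    (by intros; simp [add_mul, Finset.sum_add_distrib])
    (by intros; simp [mul_assoc, Finset.mul_sum])
    (by intros; simp [mul_add, Finset.sum_add_distrib])
    (by intros; simp [mul_left_comm, Finset.mul_sum])

theorem flipForm_apply (u v : Fin (2 * n) → ℂ) :
    flipForm P u v = ∑ m, u m * v (flipIndex P m) := rfl

theorem flipIndex_involutive : Function.Involutive (flipIndex P) := by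
  intro m
  by_cases h : P m ∨ P m.rev
  · have h' : P m.rev ∨ P m := h.symm
    simp [flipIndex, h, h']
  · simp [flipIndex, h]

theorem flipIndex_flipIndex (m : Fin (2 * n)) : flipIndex P (flipIndex P m) = m :=
  flipIndex_involutive P m

theorem flipForm_comm (u v : Fin (2 * n) → ℂ) : flipForm P u v = flipForm P v u := by
  rw [flipForm_apply, flipForm_apply,
    ← Equiv.sum_comp ((flipIndex_involutive P).toPerm)]
  refine Finset.sum_congr rfl fun m _ => ?_
  simp only [Function.Involutive.coe_toPerm, flipIndex_flipIndex, mul_comm]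

/-- On `P` and its opposites this form is the antidiagonal one, for which `X` is skew; `flipPart P
X` involves no other indices. -/
theorem flipForm_flipPart {X : Matrix (Fin (2 * n)) (Fin (2 * n)) ℂ} (hX : X ∈ so n)
    (u v : Fin (2 * n) → ℂ) :
    flipForm P (Matrix.toLin' (flipPart P X) u) v =
      -flipForm P u (Matrix.toLin' (flipPart P X) v) := by
  rw [flipForm_apply, flipForm_apply,
    ← Equiv.sum_comp ((flipIndex_involutive P).toPerm)]
  simp only [Function.Involutive.coe_toPerm, flipIndex_flipIndex, Matrix.toLin'_apply,
    Matrix.mulVec, dotProduct, Finset.sum_mul, Finset.mul_sum]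
  rw [Finset.sum_comm, ← Finset.sum_neg_distrib]
  refine Finset.sum_congr rfl fun a _ => ?_
  rw [← Finset.sum_neg_distrib]
  refine Finset.sum_congr rfl fun b _ => ?_
  have h1 : flipPart P X (flipIndex P b) a = -flipPart P X (flipIndex P a) b := by
    simp only [flipPart, Matrix.of_apply]
    by_cases ha : P a <;> by_cases hb : P b
    · simp only [flipIndex, ha, hb, true_or, if_true, Fin.rev_rev, and_self]
      exact mem_so_iff.1 hX a b
    · rw [if_neg, if_neg (fun h => hb h.1), neg_zero]
      rintro ⟨-, h⟩
      by_cases hb' : P b.rev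
      · simp [flipIndex, hb', hb] at h
      · simp [flipIndex, hb', hb] at h
    · rw [if_neg (fun h => ha h.1), if_neg, neg_zero]
      rintro ⟨-, h⟩
      by_cases ha' : P a.rev
      · simp [flipIndex, ha', ha] at h
      · simp [flipIndex, ha', ha] at h
    · simp [ha, hb]
  rw [h1]; ring

variable {P}

/-- The image is spanned by vectors with index opposite to `P`, and these are killed because `P`
contains none of them. -/
theorem toLin'_flipPart_mul (hP : ∀ m, P m → ¬P m.rev)
    (X Y : Matrix (Fin (2 * n)) (Fin (2 * n)) ℂ) :
    Matrix.toLin' (flipPart P X) * Matrix.toLin' (flipPart P Y) = 0 := by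
  rw [Module.End.mul_eq_comp, ← Matrix.toLin'_mul]
  suffices flipPart P X * flipPart P Y = 0 by rw [this, map_zero]
  ext a b
  rw [Matrix.mul_apply]
  refine Finset.sum_eq_zero fun c _ => ?_
  simp only [flipPart, Matrix.of_apply]
  by_cases h : P c
  · rw [if_neg (c := P b ∧ P c.rev) fun h' => hP c h h'.2, mul_zero]
  · rw [if_neg fun h' => h h'.1, zero_mul]

/-- Only entries from `P` to its opposite raise the height by 2; all others raise it by at most 1.
Below the maximal possible height nothing is controlled, but at that height each factor may be
replaced by its flip part. -/
theorem prod_sub_prod_flipPart_mem (g : Fin k → Fin (2 * n)) (xs : List (so n)) :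
    (xs.map (extRep n k)).prod (wedge g) ∈
        heightFiltration k (flipHeight P) (∑ l, flipHeight P (g l) + 2 * xs.length) ∧
      (xs.map (extRep n k)).prod (wedge g) -
          ((xs.map fun x => Matrix.toLin' (flipPart P x.1)).map (act k)).prod (wedge g) ∈
        heightFiltration k (flipHeight P) (∑ l, flipHeight P (g l) + 2 * xs.length - 1) := by
  induction xs with
  | nil => exact ⟨wedge_mem_heightFiltration (by simp), by simp⟩
  | cons x xs ih =>
    obtain ⟨h1, h2⟩ := ih
    have hx : ∀ m j, x.1 m j ≠ 0 → flipHeight P m ≤ flipHeight P j + 2 := by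
      intro m j _
      simp only [flipHeight]
      split_ifs <;> norm_num
    have hd : ∀ m j, (x.1 - flipPart P x.1) m j ≠ 0 → flipHeight P m ≤ flipHeight P j + 1 := by
      intro m j h
      by_cases hmj : P j ∧ P m.rev
      · simp [flipPart, hmj] at h
      · simp only [flipHeight]
        split_ifs <;> first | exact absurd ⟨‹_›, ‹_›⟩ hmj | norm_num
    simp only [List.map_cons, List.prod_cons, Module.End.mul_apply, extRep_apply, List.length_cons,
      Nat.cast_succ]
    set p := (xs.map (extRep n k)).prod (wedge g)
    set q := ((xs.map fun x => Matrix.toLin' (flipPart P x.1)).map (act k)).prod (wedge g)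
    constructor
    · refine heightFiltration_mono _ (le_of_eq ?_) (act_mem_heightFiltration hx h1)
      ring
    · have hq : q ∈ heightFiltration k (flipHeight P)
          (∑ l, flipHeight P (g l) + 2 * xs.length) := by
        have := Submodule.sub_mem _ h1 (heightFiltration_mono _ (by linarith) h2)
        rwa [sub_sub_cancel] at this
      have e : act k (Matrix.toLin' x.1) p - act k (Matrix.toLin' (flipPart P x.1)) q =
          act k (Matrix.toLin' x.1) (p - q) +
            act k (Matrix.toLin' (x.1 - flipPart P x.1)) q := by
        have : act k (Matrix.toLin' (x.1 - flipPart P x.1)) =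
            act k (Matrix.toLin' x.1) - act k (Matrix.toLin' (flipPart P x.1)) := by
          rw [map_sub]
          exact (rep ℂ (Fin (2 * n) → ℂ) k).map_sub _ _
        rw [this, map_sub, LinearMap.sub_apply]
        abel
      rw [e]
      refine Submodule.add_mem _ ?_ ?_
      · refine heightFiltration_mono _ (le_of_eq ?_) (act_mem_heightFiltration hx h2)
        ring
      · refine heightFiltration_mono _ (le_of_eq ?_) (act_mem_heightFiltration hd hq)
        ring

/-- The coefficient at the flipped tuple is the pairing with `wedge g` itself, so the vanishing for
odd products of commuting skew-adjoint operators applies. -/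
theorem coeff_prod_flipPart_eq_zero (hP : ∀ m, P m → ¬P m.rev) (g : Fin k → Fin (2 * n))
    {xs : List (so n)} (ho : Odd xs.length) :
    coeff (flipIndex P ∘ g)
      (((xs.map fun x => Matrix.toLin' (flipPart P x.1)).map (act k)).prod (wedge g)) = 0 := by
  have h1 : coeff (flipIndex P ∘ g) = wedgeForm k (flipForm P) (wedge g) := by
    refine ext_wedge fun g' => ?_
    rw [wedge, wedge, coeff_ιMulti, wedgeForm_ιMulti]
    congr 1
    ext i j
    simp only [Matrix.of_apply, flipForm_apply, Function.comp_apply]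
    rw [Finset.sum_eq_single (g j) (fun b _ hb => by rw [Pi.single_eq_of_ne hb, zero_mul]) (by simp),
      Pi.single_eq_same, one_mul]
  rw [h1]
  refine wedgeForm_prod_eq_zero_of_odd (flipForm_comm P) ?_ ?_ (by simpa using ho) _
  · intro y hy
    obtain ⟨x, -, rfl⟩ := List.mem_map.1 hy
    exact flipForm_flipPart P x.2
  · intro y hy z hz
    obtain ⟨x, -, rfl⟩ := List.mem_map.1 hy
    obtain ⟨x', -, rfl⟩ := List.mem_map.1 hz
    rw [toLin'_flipPart_mul hP, toLin'_flipPart_mul hP]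

end Odd

theorem numFlip_lt_of_mem_filtration (hkn : k < n) (hf : Admissible hk f) (ha : numMid hk f = 0)
    (hb : Odd (numFlip hk f)) {s : ℕ}
    (h : wedge f ∈ PBW.filtration (extRep n k) (nMinus n) (highestVector hk) s) :
    numFlip hk f < s := by
  classical
  by_contra! hs
  rw [numMid_eq_zero_iff] at ha
  have hne := castLE_ne_rev (hk := hk) hkn
  set P : Fin (2 * n) → Prop := fun m => ∃ i, f i = (i.castLE hk).rev ∧ m = i.castLE hk with hPdef
  have hP : ∀ m, P m → ¬P m.rev := by
    rintro _ ⟨i, -, rfl⟩ ⟨j, -, e⟩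
    exact hne j i e.symm
  have hPlo : ∀ i : Fin k, P (i.castLE hk) ↔ f i = (i.castLE hk).rev := by
    refine fun i => ⟨?_, fun h => ⟨i, h, rfl⟩⟩
    rintro ⟨j, hj, e⟩
    rwa [Fin.castLE_injective hk e]
  have hPrev : ∀ i : Fin k, ¬P (i.castLE hk).rev := by
    rintro i ⟨j, -, e⟩
    exact hne _ _ e.symm
  have hfP : f = flipIndex P ∘ Fin.castLE hk := by
    funext i
    simp only [flipIndex, Function.comp_apply, hPlo, hPrev, or_false]
    split_ifs with h
    exacts [h, (ha i).resolve_right h]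
  have hlo : ∑ i : Fin k, flipHeight P (i.castLE hk) = -(numFlip hk f : ℤ) := by
    rw [numFlip, ← Finset.sum_boole, ← Finset.sum_neg_distrib]
    refine Finset.sum_congr rfl fun i _ => ?_
    simp only [flipHeight, hPlo, hPrev, if_false]
    split_ifs <;> rfl
  have hhi : ∑ i : Fin k, flipHeight P (f i) = numFlip hk f := by
    rw [numFlip, ← Finset.sum_boole]
    refine Finset.sum_congr rfl fun i _ => ?_
    by_cases hi : f i = (i.castLE hk).rev
    · rw [if_pos hi, hi, flipHeight, if_neg (hPrev i), Fin.rev_rev, if_pos ((hPlo i).2 hi)]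
    · rw [if_neg hi, (ha i).resolve_right hi, flipHeight, if_neg (fun h => hi ((hPlo i).1 h)),
        if_neg (hPrev i)]
  have key : PBW.filtration (extRep n k) (nMinus n) (highestVector hk) s ≤
      LinearMap.ker (coeff f) := by
    refine Submodule.span_le.2 ?_
    rintro _ ⟨xs, -, hxs, rfl⟩
    rw [highestVector_eq_wedge, SetLike.mem_coe, LinearMap.mem_ker]
    obtain ⟨h1, h2⟩ := prod_sub_prod_flipPart_mem (P := P) (Fin.castLE hk) xs
    -- Fewer than `numFlip hk f` factors cannot climb from `-numFlip hk f` to `numFlip hk f`. With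
    -- exactly that many, the coefficient is that of the product of flip parts.
    rcases (hxs.trans hs).lt_or_eq with hlt | heq
    · exact coeff_eq_zero_of_mem_heightFiltration (by rw [hhi, hlo]; omega) h1
    · have h3 := coeff_eq_zero_of_mem_heightFiltration (f := f) (by rw [hhi, hlo]; omega) h2
      have h4 := coeff_prod_flipPart_eq_zero hP (Fin.castLE hk) (heq ▸ hb)
      rw [← hfP] at h4
      rwa [map_sub, h4, sub_zero] at h3
  have h5 := key h
  rw [LinearMap.mem_ker, coeff_wedge_self hf.inj] at h5
  exact one_ne_zero h5

theorem hasDegree_wedge (hkn : k < n) (hf : Admissible hk f) :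
    PBW.HasDegree (extRep n k) (nMinus n) (highestVector hk) (wedge f)
      (numMid hk f + numFlip hk f + if numMid hk f = 0 ∧ Odd (numFlip hk f) then 1 else 0) := by
  refine ⟨wedge_mem_filtration hkn hf, fun s hs => ?_⟩
  have h1 := counts_le_of_mem_filtration hkn hf hs
  split_ifs with h
  · have := numFlip_lt_of_mem_filtration hkn hf h.1 h.2 hs
    omega
  · exact h1

end TypeD

namespace TypeD

open ExtPow exteriorPower

variable {n k : ℕ} {hk : k ≤ 2 * n} {f : Fin k → Fin (2 * n)}

/-! ### Weight spaces -/

/-- The diagonal matrix in `so n` with `t_c = 1` and the other `t_i` equal to zero. -/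
def cartan (c : Fin n) : so n :=
  ⟨Matrix.diagonal fun m => (wt m c : ℂ), by
    rw [mem_so_iff]
    intro a b
    simp only [Matrix.diagonal_apply, wt_rev, Pi.neg_apply, Int.cast_neg, Fin.rev_eq_iff,
      eq_comm (a := b)]
    split_ifs with h
    · rw [h, wt_rev]; simp
    · simp⟩

theorem wt_apply_castLE (c a : Fin n) (h : n ≤ 2 * n) :
    wt (a.castLE h) c = if a = c then 1 else 0 := by
  rw [wt_castLE, Pi.single_apply]
  simp only [eq_comm]

theorem cartan_wedge (c : Fin n) (g : Fin k → Fin (2 * n)) :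
    extRep n k (cartan c) (wedge g) = (tupleWeight g c : ℂ) • wedge g := by
  rw [extRep_apply, act_toLin'_wedge, tupleWeight, Finset.sum_apply, Int.cast_sum, Finset.sum_smul]
  refine Finset.sum_congr rfl fun l _ => ?_
  rw [Finset.sum_eq_single (g l)]
  · rw [Function.update_eq_self]
    simp [cartan]
  · intro m _ hm
    simp [cartan, Matrix.diagonal_apply_ne _ hm]
  · simp

theorem HasWeight.cartan_apply {μ : Fin n → ℤ} {v : ⋀[ℂ]^k (Fin (2 * n) → ℂ)}
    (hv : HasWeight μ v) (c : Fin n) : extRep n k (cartan c) v = (μ c : ℂ) • v := by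
  rw [hv (cartan c) (Matrix.isDiag_diagonal _)]
  congr 1
  rw [Finset.sum_eq_single c]
  · simp [cartan, wt_apply_castLE]
  · intro b _ hb
    simp [cartan, wt_apply_castLE, hb]
  · simp

theorem exists_apply_eq_iff_sum_pos {ι κ : Type*} [Fintype ι] [DecidableEq κ] (g : ι → κ) (m : κ) :
    (∃ l, g l = m) ↔ 0 < ∑ l, if g l = m then (1 : ℤ) else 0 := by
  rw [Finset.sum_boole, Nat.cast_pos, Finset.card_pos]
  simp [Finset.Nonempty]

/-- The tuple of an extremal weight vector is determined by its weight up to the order. -/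
theorem exists_perm_of_tupleWeight_eq (hinj : Function.Injective f)
    (hiso : ∀ i j, f i ≠ (f j).rev) {g : Fin k → Fin (2 * n)}
    (h : tupleWeight g = tupleWeight f) : ∃ σ : Equiv.Perm (Fin k), f ∘ σ = g := by
  have h1 : ∀ m : Fin (2 * n), ∑ l, ((if g l = m then (1 : ℤ) else 0) - if g l = m.rev then 1 else 0)
      = ∑ l, ((if f l = m then (1 : ℤ) else 0) - if f l = m.rev then 1 else 0) := by
    intro m
    obtain ⟨c, hc⟩ := exists_eq_castLE_or_rev m (by omega)
    have h2 := congrFun h c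
    simp only [tupleWeight, Finset.sum_apply, wt] at h2
    rcases hc with rfl | rfl
    · exact h2
    · simp only [Fin.rev_rev, Finset.sum_sub_distrib] at h2 ⊢
      linarith
  -- The weight determines the multiplicity of each index minus that of its opposite. At `f l` this
  -- is 1 for `f`, so `g` must take that value.
  have h3 : ∀ l, ∃ l', g l' = f l := by
    intro l
    rw [exists_apply_eq_iff_sum_pos]
    have h4 := h1 (f l)
    rw [Finset.sum_sub_distrib, Finset.sum_sub_distrib,
      sum_ite_apply_eq (i := l) rfl fun _ h => hinj h, sum_ite_apply_ne fun l' => hiso l' l] at h4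
    have h5 : 0 ≤ ∑ l', if g l' = (f l).rev then (1 : ℤ) else 0 :=
      Finset.sum_nonneg fun _ _ => by split_ifs <;> norm_num
    linarith
  choose τ hτ using h3
  have hτi : Function.Injective τ := fun a b hab => hinj (by rw [← hτ, ← hτ, hab])
  let σ := Equiv.ofBijective τ (Finite.injective_iff_bijective.1 hτi)
  refine ⟨σ.symm, funext fun l => ?_⟩
  rw [Function.comp_apply, ← hτ]
  exact congrArg g (σ.apply_symm_apply l)

/-- In the basis of wedges the Cartan elements are diagonal, so only basis wedges of the given
weight survive, and these are reorderings of `wedge f`. -/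
theorem HasWeight.exists_eq_smul_wedge {v : ⋀[ℂ]^k (Fin (2 * n) → ℂ)}
    (hv : HasWeight (tupleWeight f) v) (hinj : Function.Injective f)
    (hiso : ∀ i j, f i ≠ (f j).rev) : ∃ a : ℂ, v = a • wedge f := by
  let b := (Pi.basisFun ℂ (Fin (2 * n))).exteriorPower k
  let e := fun s : Set.powersetCard (Fin (2 * n)) k => Set.powersetCard.ofFinEmbEquiv.symm s
  have hb : ∀ s, b s = wedge (e s) := by
    intro s
    rw [basis_apply, ιMulti_family, wedge]
    congr 1
    funext l
    simp [e]
  have h1 : ∀ c s, b.repr (extRep n k (cartan c) v) s = tupleWeight (e s) c * b.repr v s := by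
    intro c s
    suffices b.coord s ∘ₗ extRep n k (cartan c) = (tupleWeight (e s) c : ℂ) • b.coord s from
      LinearMap.congr_fun this v
    refine b.ext fun t => ?_
    rw [LinearMap.comp_apply, hb, cartan_wedge, ← hb, LinearMap.smul_apply, map_smul,
      Module.Basis.coord_apply, Module.Basis.repr_self]
    rcases eq_or_ne t s with rfl | h
    · rfl
    · simp [Finsupp.single_eq_of_ne h.symm]
  have h2 : v ∈ Submodule.span ℂ {wedge f} := by
    rw [← b.sum_repr v]
    refine Submodule.sum_mem _ fun s _ => ?_
    by_cases h0 : b.repr v s = 0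
    · simp [h0]
    refine Submodule.smul_mem _ _ ?_
    have h3 : tupleWeight (e s) = tupleWeight f := by
      funext c
      have h4 := h1 c s
      rw [hv.cartan_apply, map_smul, Finsupp.smul_apply, smul_eq_mul] at h4
      exact_mod_cast (mul_right_cancel₀ h0 h4).symm
    obtain ⟨σ, hσ⟩ := exists_perm_of_tupleWeight_eq hinj hiso h3
    rw [hb, ← hσ, wedge_comp_perm, Units.smul_def, ← Int.cast_smul_eq_zsmul ℂ]
    exact Submodule.smul_mem _ _ (Submodule.mem_span_singleton_self _)
  obtain ⟨a, ha⟩ := Submodule.mem_span_singleton.1 h2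
  exact ⟨a, ha.symm⟩

/-! ### The Weyl group orbit of `omega` -/

/-- The weights with `k` coordinates `±1` and the others equal to zero. -/
def IsExtremal (k : ℕ) (μ : Fin n → ℤ) : Prop :=
  (∀ c, μ c = 0 ∨ μ c = 1 ∨ μ c = -1) ∧ (Finset.univ.filter fun c => μ c ≠ 0).card = k

theorem isExtremal_omega (hkn : k < n) : IsExtremal k (omega n k) := by
  refine ⟨fun c => ?_, ?_⟩
  · rw [omega]; split_ifs <;> simp
  · have : (Finset.univ.filter fun c => omega n k c ≠ 0) =
        Finset.univ.map (Fin.castLEEmb hkn.le) := by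
      ext c
      simp only [omega, Finset.mem_filter, Finset.mem_univ, true_and, Finset.mem_map, ne_eq,
        ite_eq_right_iff, one_ne_zero, imp_false, not_not, Fin.castLEEmb_apply]
      exact ⟨fun h => ⟨⟨c, h⟩, rfl⟩, by rintro ⟨i, rfl⟩; exact i.2⟩
    rw [this, Finset.card_map, Finset.card_univ, Fintype.card_fin]

theorem IsExtremal.signedPerm {μ ν : Fin n → ℤ} (hμ : IsExtremal k μ) (σ : Equiv.Perm (Fin n))
    (h : ∀ c, ν c = μ (σ c) ∨ ν c = -μ (σ c)) : IsExtremal k ν := by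
  refine ⟨fun c => ?_, ?_⟩
  · have := hμ.1 (σ c)
    have := h c
    omega
  · rw [← hμ.2]
    refine Finset.card_equiv σ fun c => ?_
    have := h c
    simp only [Finset.mem_filter, Finset.mem_univ, true_and]
    omega

/-- The reflection in `ε_i - ε_j` swaps two coordinates; the one in `ε_i + ε_j` swaps and negates
them. -/
theorem reflection_apply {α : Fin n → ℤ} (hα : α ∈ posRoots n) :
    ∃ σ : Equiv.Perm (Fin n), ∀ (x : Fin n → ℤ) (c : Fin n),
      (x - (x ⬝ᵥ α) • α) c = x (σ c) ∨ (x - (x ⬝ᵥ α) • α) c = -x (σ c) := by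
  obtain ⟨i, j, hij, rfl | rfl⟩ := hα
  all_goals
    refine ⟨Equiv.swap i j, fun x c => ?_⟩
    simp only [dotProduct_sub, dotProduct_add, dotProduct_single, mul_one, Pi.sub_apply,
      Pi.smul_apply, Pi.add_apply, smul_eq_mul, Pi.single_apply, Equiv.swap_apply_def]
    split_ifs with h1 h2 h2
    · exact absurd (h1.symm.trans h2) hij.ne
    · subst h1; omega
    · subst h2; omega
    · omega

/-- Stated as an equivalence for all `μ` so that the induction passes through inverses. -/
theorem isExtremal_weylGroup {w : (Fin n → ℤ) ≃ₗ[ℤ] (Fin n → ℤ)} (hw : w ∈ weylGroup n)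
    (μ : Fin n → ℤ) : IsExtremal k (w μ) ↔ IsExtremal k μ := by
  induction hw using Subgroup.closure_induction generalizing μ with
  | mem g hg =>
    obtain ⟨α, hα, hg⟩ := hg
    obtain ⟨σ, hσ⟩ := reflection_apply hα
    refine ⟨fun h => h.signedPerm σ.symm fun c => ?_, fun h => h.signedPerm σ fun c => ?_⟩
    · have := hσ μ (σ.symm c)
      rw [← hg, Equiv.apply_symm_apply] at this
      omega
    · rw [hg]; exact hσ μ c
  | one => rfl
  | mul a b _ _ ha hb => exact (ha (b μ)).trans (hb μ)
  | inv a _ ha =>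
    rw [← ha]
    exact iff_of_eq (congrArg _ (a.apply_symm_apply μ))

/-- An injection of `{0, …, k-1}` onto a set of `k` elements, which fixes what it can. -/
theorem exists_injective_onto (hkn : k ≤ n) (B : Finset (Fin n)) (hB : B.card = k) :
    ∃ π : Fin k → Fin n, Function.Injective π ∧ (∀ c, c ∈ B ↔ ∃ i, π i = c) ∧
      ∀ i, π i = i.castLE hkn ∨ k ≤ (π i : ℕ) := by
  classical
  let A : Finset (Fin n) := Finset.univ.map (Fin.castLEEmb hkn)
  have hA : ∀ i : Fin k, i.castLE hkn ∈ A := fun i =>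
    Finset.mem_map.2 ⟨i, Finset.mem_univ _, rfl⟩
  have hA' : ∀ c, c ∉ A → k ≤ (c : ℕ) := by
    intro c hc
    by_contra! h
    exact hc (hA ⟨c, h⟩)
  -- Equal cardinalities allow matching the low indices missing from `B` with the elements of `B`
  -- that are not low.
  have hcard : (A \ B).card = (B \ A).card := Finset.card_sdiff_comm (by simp [A, hB])
  let e := Finset.equivOfCardEq hcard
  have he : ∀ x, (e x : Fin n) ∈ B ∧ (e x : Fin n) ∉ A := fun x => Finset.mem_sdiff.1 (e x).2
  let π : Fin k → Fin n := fun i =>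
    if h : i.castLE hkn ∈ B then i.castLE hkn else e ⟨_, Finset.mem_sdiff.2 ⟨hA i, h⟩⟩
  have hinj : Function.Injective π := by
    intro i j hij
    simp only [π] at hij
    split_ifs at hij with h1 h2 h2
    · exact Fin.castLE_injective hkn hij
    · exact absurd (hij ▸ hA i) (he _).2
    · exact absurd (hij ▸ hA j) (he _).2
    · have := e.injective (Subtype.ext hij)
      exact Fin.castLE_injective hkn (congrArg Subtype.val this)
  have hmem : ∀ i, π i ∈ B := by
    intro i
    simp only [π]
    split_ifs with h
    exacts [h, (he _).1]
  refine ⟨π, hinj, fun c => ⟨fun hc => ?_, fun ⟨i, hi⟩ => hi ▸ hmem i⟩, fun i => ?_⟩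
  · have h1 : Finset.univ.image π = B :=
      Finset.eq_of_subset_of_card_le (Finset.image_subset_iff.2 fun i _ => hmem i)
        (by rw [Finset.card_image_of_injective _ hinj, hB, Finset.card_univ, Fintype.card_fin])
    rw [← h1] at hc
    simpa using hc
  · simp only [π]
    split_ifs with h
    exacts [Or.inl rfl, Or.inr (hA' _ (he _).2)]

/-- The support of `μ` is enumerated with low coordinates kept at their own positions, and the sign
of each coordinate chooses between an index and its opposite. -/
theorem IsExtremal.exists_admissible (hkn : k < n) (hk : k ≤ 2 * n) {μ : Fin n → ℤ}
    (hμ : IsExtremal k μ) : ∃ f : Fin k → Fin (2 * n), Admissible hk f ∧ tupleWeight f = μ := by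
  obtain ⟨π, hinj, hmem, hπ⟩ := exists_injective_onto hkn.le _ hμ.2
  have hn : n ≤ 2 * n := by omega
  let f : Fin k → Fin (2 * n) := fun i =>
    if μ (π i) = 1 then (π i).castLE hn else ((π i).castLE hn).rev
  have hne := fun a b : Fin n => castLE_two_mul_ne_rev a b hn
  refine ⟨f, ⟨?_, ?_, ?_⟩, ?_⟩
  · intro i j hij
    simp only [f] at hij
    split_ifs at hij
    · exact hinj (Fin.castLE_injective hn hij)
    · exact absurd hij (hne _ _)
    · exact absurd hij.symm (hne _ _)
    · exact hinj (Fin.castLE_injective hn (Fin.rev_injective hij))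
  · intro i j hij
    simp only [f] at hij
    split_ifs at hij with h1 h2 h2
    · exact hne _ _ hij
    · rw [Fin.rev_rev] at hij
      rw [Fin.castLE_injective hn hij] at h1
      exact h2 h1
    · rw [Fin.rev_inj] at hij
      rw [Fin.castLE_injective hn hij] at h1
      exact h1 h2
    · rw [Fin.rev_rev] at hij
      exact hne _ _ hij.symm
  · intro i
    have h1 := i.2
    have h2 := (π i).2
    rcases hπ i with h | h
    · simp only [f, h]
      split_ifs
      exacts [Or.inl rfl, Or.inr (Or.inl rfl)]
    · refine Or.inr (Or.inr ?_)
      simp only [f]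
      split_ifs <;> simp only [Fin.rev_rev, Fin.val_rev, Fin.val_castLE] <;> omega
  · funext c
    have hf : ∀ l, wt (f l) c = if π l = c then μ c else 0 := by
      intro l
      have h0 : μ (π l) ≠ 0 := (Finset.mem_filter.1 ((hmem _).2 ⟨l, rfl⟩)).2
      have h1 := hμ.1 (π l)
      simp only [f]
      split_ifs with h2 h3 h3
      · rw [wt_apply_castLE, if_pos h3, ← h3, h2]
      · rw [wt_apply_castLE, if_neg h3]
      · rw [wt_rev, Pi.neg_apply, wt_apply_castLE, if_pos h3, ← h3]
        omega
      · rw [wt_rev, Pi.neg_apply, wt_apply_castLE, if_neg h3, neg_zero]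
    rw [tupleWeight, Finset.sum_apply, Finset.sum_congr rfl fun l _ => hf l]
    by_cases hc : μ c = 0
    · simp [hc]
    · obtain ⟨i, hi⟩ := (hmem c).1 (Finset.mem_filter.2 ⟨Finset.mem_univ _, hc⟩)
      rw [sum_ite_apply_eq hi fun l hl => hinj (hl.trans hi.symm)]

/-! ### The special vectors -/

theorem flipWedge_eq_wedge (hk : k ≤ 2 * n) (I : Finset (Fin k)) :
    flipWedge hk I = wedge fun i => if i ∈ I then (i.castLE hk).rev else i.castLE hk := by
  rw [flipWedge, wedge]
  congr 1
  funext i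
  split_ifs <;> rfl

theorem isSpecial_iff (hkn : k < n) (hf : Admissible hk f) {a : ℂ} (ha : a ≠ 0) :
    IsSpecial hk (a • wedge f) ↔
      numMid hk f = 0 ∧ Odd (numFlip hk f) ∧ 3 ≤ numFlip hk f := by
  constructor
  · rintro ⟨I, s, c, hI, hc, h⟩
    rw [flipWedge_eq_wedge] at h
    have h1 : coeff f (wedge fun i => if i ∈ I then (i.castLE hk).rev else i.castLE hk) ≠ 0 := by
      intro h0
      have := congrArg (coeff f) h
      rw [map_smul, map_smul, h0, coeff_wedge_self hf.inj, smul_zero, smul_eq_mul, mul_one] at this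
      exact ha this
    obtain ⟨σ, hσ⟩ := exists_perm_of_coeff_wedge_ne_zero h1
    have h2 : ∀ i, f i = if i ∈ I then (i.castLE hk).rev else i.castLE hk := by
      intro i
      have h3 := congrFun hσ i
      -- In normal form the values `i` and `i'` can occur only at position `i`, so no reordering is
      -- possible.
      have h4 : σ i = i := by
        simp only [Function.comp_apply] at h3
        split_ifs at h3
        exacts [hf.eq_of_apply_eq_rev hkn h3, hf.eq_of_apply_eq hkn h3]
      rwa [Function.comp_apply, h4] at h3
    have h5 : numFlip hk f = 2 * s + 3 := by
      rw [numFlip, ← hI]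
      congr 1
      ext i
      simp only [h2, Finset.mem_filter, Finset.mem_univ, true_and]
      split_ifs with hi
      · simp [hi]
      · simp [hi, castLE_ne_rev hkn]
    refine ⟨numMid_eq_zero_iff.2 fun i => ?_, ⟨s + 1, by omega⟩, by omega⟩
    rw [h2]
    split_ifs <;> simp
  · rintro ⟨h1, ⟨s, hs⟩, h3⟩
    rw [numMid_eq_zero_iff] at h1
    -- Oddness gives `2 * s + 1` flips with `s ≥ 1`, that is `2 * (s - 1) + 3`.
    refine ⟨Finset.univ.filter fun i => f i = (i.castLE hk).rev, s - 1, a, ?_, ha, ?_⟩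
    · rw [numFlip] at hs h3
      omega
    · rw [flipWedge_eq_wedge]
      congr 2
      funext i
      simp only [Finset.mem_filter, Finset.mem_univ, true_and]
      split_ifs with hi
      exacts [hi, (h1 i).resolve_right hi]

end TypeD

/-! ### Comparison of the two degrees -/

theorem PBW.HasDegree.smul {L M : Type*} [LieRing L] [LieAlgebra ℂ L] [AddCommGroup M]
    [Module ℂ M] {ρ : L →ₗ⁅ℂ⁆ Module.End ℂ M} {N : LieSubalgebra ℂ L} {v₀ v : M} {d : ℕ}
    (h : PBW.HasDegree ρ N v₀ v d) {a : ℂ} (ha : a ≠ 0) : PBW.HasDegree ρ N v₀ (a • v) d := by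
  rw [PBW.HasDegree] at h ⊢
  simpa only [Submodule.smul_mem_iff _ ha] using h

theorem proposition5p5 (n k : ℕ) (hk1 : 1 ≤ k) (hk2 : k + 2 ≤ n)
    (w : (Fin n → ℤ) ≃ₗ[ℤ] (Fin n → ℤ)) (hw : w ∈ TypeD.weylGroup n)
    (v : ⋀[ℂ]^k (Fin (2 * n) → ℂ)) (hv0 : v ≠ 0)
    (hv : TypeD.HasWeight (w (TypeD.omega n k)) v) :
    ∃ N d : ℕ,
      TypeD.IsKostantDegree (TypeD.omega n k) w N ∧
      PBW.HasDegree (TypeD.extRep n k) (TypeD.nMinus n)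
        (TypeD.highestVector (n := n) (k := k) (by omega)) v d ∧
      (¬ TypeD.IsSpecial (by omega) v → d = N) ∧
      (TypeD.IsSpecial (by omega) v → d = N + 1) := by
  have hkn : k < n := by omega
  have hk : k ≤ 2 * n := by omega
  obtain ⟨f, hf, hwt⟩ := ((TypeD.isExtremal_weylGroup hw _).2
    (TypeD.isExtremal_omega hkn)).exists_admissible hkn hk
  rw [← hwt] at hv
  obtain ⟨a, rfl⟩ := hv.exists_eq_smul_wedge hf.inj hf.iso
  have ha : a ≠ 0 := by
    rintro rfl
    exact hv0 (zero_smul _ _)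
  have hN := TypeD.isLeast_hasDecomposition hkn hf
  simp only [TypeD.HasDecomposition, hwt] at hN
  refine ⟨_, _, hN, (TypeD.hasDegree_wedge hkn hf).smul ha, ?_, ?_⟩
  · rw [TypeD.isSpecial_iff hkn hf ha]
    intro h
    -- The two formulas differ only in the condition for the extra unit: odd versus equal to 1.
    -- These agree unless there are at least three flips.
    congr 2
    refine propext (and_congr_right fun h1 => ⟨fun h2 => ?_, fun h2 => h2 ▸ odd_one⟩)
    obtain ⟨m, hm⟩ := id h2
    by_contra h3
    exact h ⟨h1, h2, by omega⟩
  · rw [TypeD.isSpecial_iff hkn hf ha]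
    rintro ⟨h1, h2, h3⟩
    rw [if_pos ⟨h1, h2⟩, if_neg (by omega)]
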